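/- Let $\mathcal H$ be a complex Hilbert space, $I$ its identity operator, and $\mathbb P$ the cone of positive invertible (positive definite) bounded linear operators on $\mathcal H$, with the Loewner order $\le$. Let $\Delta_n$ denote the simplex of probability vectors in $\mathbb R^n$. An *ordered mean* is a family $G=\{G_n\}_{n\in\mathbb N}$ of maps $G_n:\Delta_n\times\mathbb P^n\to\mathbb P$ such that, for all $\omega=(w_1,\dots,w_n)\in\Delta_n$ and $\mathbf A,\mathbf B\in\mathbb P^n$: $G_n(\omega;a\mathbf A)=aG_n(\omega;\mathbf A)$ for $a>0$; $G_n(\omega;\mathbf B)\le G_n(\omega;\mathbf A)$ if $B_i\le A_i$ for all $i$; $G_n(\omega;(1-s)\mathbf A+s\mathbf B)\ge(1-s)G_n(\omega;\mathbf A)+sG_n(\omega;\mathbf B)$ for $0\le s\le1$; and $\big[\sum_i w_iA_i^{-1}\big]^{-1}\le G_n(\omega;\mathbf A)\le\sum_i w_iA_i$. For $\mu\ge0$ put $$G^{\mu}(\omega;\mathbf A)=G_n(\omega;A_1+\mu I,\dots,A_n+\mu I)-\mu I .$$ For $X,Y\in\mathbb P$ let $X\#_pY=X^{1/2}(X^{-1/2}YX^{-1/2})^pX^{1/2}$.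 For $\lambda\in\Delta_k$ and $\mathbf B\in\mathbb P^k$, the *power mean* $P_p(\lambda;\mathbf B)$ is: for $p\in(0,1]$ the unique $X\in\mathbb P$ with $X=\sum_j\lambda_j\,(X\#_pB_j)$; for $p=0$ the Karcher mean, i.e. the unique $X\in\mathbb P$ with $\sum_j\lambda_j\log\big(X^{1/2}B_j^{-1}X^{1/2}\big)=0$; and for $p\in[-1,0)$ it is $P_{-p}(\lambda;B_1^{-1},\dots,B_k^{-1})^{-1}$. For positive real numbers $\mu_1,\dots,\mu_k$ we have $P_p(\lambda;\mu_1,\dots,\mu_k)=\big(\sum_j\lambda_j\mu_j^p\big)^{1/p}$ if $p\ne0$ and $P_0(\lambda;\mu_1,\dots,\mu_k)=\prod_j\mu_j^{\lambda_j}$. **Proposition.** Let $G$ be an ordered mean, $\mathbf A\in\mathbb P^n$, $\omega\in\Delta_n$ and $\lambda\in\Delta_k$. Then for all $\mu_1,\dots,\mu_k>0$ and all $p\in[-1,1)$ $$G^{P_p(\lambda;\mu_1,\dots,\mu_k)}(\omega;\mathbf A)\ \ge\ P_p\big(\lambda;\,G^{\mu_1/K}(\omega;\mathbf A),\dots,G^{\mu_k/K}(\omega;\mathbf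 A)\big),$$ where $K=\dfrac{(\mu_{\max}+\mu_{\min})^2}{4\mu_{\max}\mu_{\min}}$, $\mu_{\max}=\max_j\mu_j$ and $\mu_{\min}=\min_j\mu_j$. -/

import Mathlib

namespace OpMean

open scoped Ring

variable {A : Type*} [CStarAlgebra A] [PartialOrder A] [StarOrderedRing A]

/-! ### Ordered means

Positive definite (that is, positive and invertible) operators are the elements that satisfy
`IsStrictlyPositive`, real powers and the logarithm are those of the continuous functional
calculus, `⁻¹ʳ` is the inverse of an invertible element, and `stdSimplex ℝ (Fin n)` is the set of
probability vectors of length `n`. Everything is written for a unital C⋆-algebra with its usual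
order; the algebra `B(H)` of bounded operators with the Loewner order is the case of interest. -/

/-- An ordered mean: a family of maps `G n` from (probability vectors) × (tuples of positive definite
operators) to positive definite operators which is homogeneous, monotone, jointly concave, and
lies between the weighted harmonic and the weighted arithmetic mean. Values of `G n` outside of this
domain play no role. -/
structure OrderedMean (A : Type*) [CStarAlgebra A] [PartialOrder A] [StarOrderedRing A] where
  /-- the `n`-variable mean `G n ω 𝐀` -/
  toFun : (n : ℕ) → (Fin n → ℝ) → (Fin n → A) → A
  isStrictlyPositive : ∀ {n : ℕ} {w : Fin n → ℝ} {X : Fin n → A}, w ∈ stdSimplex ℝ (Fin n) →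
    (∀ i, IsStrictlyPositive (X i)) → IsStrictlyPositive (toFun n w X)
  homogeneous : ∀ {n : ℕ} {w : Fin n → ℝ} {X : Fin n → A} {a : ℝ}, w ∈ stdSimplex ℝ (Fin n) →
    (∀ i, IsStrictlyPositive (X i)) → 0 < a →
    toFun n w (fun i => a • X i) = a • toFun n w X
  monotone : ∀ {n : ℕ} {w : Fin n → ℝ} {X Y : Fin n → A}, w ∈ stdSimplex ℝ (Fin n) →
    (∀ i, IsStrictlyPositive (X i)) → (∀ i, IsStrictlyPositive (Y i)) →
    (∀ i, Y i ≤ X i) → toFun n w Y ≤ toFun n w X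
  jointlyConcave : ∀ {n : ℕ} {w : Fin n → ℝ} {X Y : Fin n → A} {s : ℝ},
    w ∈ stdSimplex ℝ (Fin n) → (∀ i, IsStrictlyPositive (X i)) →
    (∀ i, IsStrictlyPositive (Y i)) → 0 ≤ s → s ≤ 1 →
    (1 - s) • toFun n w X + s • toFun n w Y ≤ toFun n w (fun i => (1 - s) • X i + s • Y i)
  harmonic_le : ∀ {n : ℕ} {w : Fin n → ℝ} {X : Fin n → A}, w ∈ stdSimplex ℝ (Fin n) →
    (∀ i, IsStrictlyPositive (X i)) → (∑ i, w i • (X i)⁻¹ʳ)⁻¹ʳ ≤ toFun n w X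
  le_arithmetic : ∀ {n : ℕ} {w : Fin n → ℝ} {X : Fin n → A}, w ∈ stdSimplex ℝ (Fin n) →
    (∀ i, IsStrictlyPositive (X i)) → toFun n w X ≤ ∑ i, w i • X i

/-- The parameterized ordered mean `G^μ(ω; 𝐀)`: it is `G(ω; 𝐀 + μ𝐈) - μI` for `μ ≥ 0`, and
`G^{-μ}(ω; 𝐀⁻¹)⁻¹` for `μ < 0`. -/
noncomputable def OrderedMean.param (G : OrderedMean A) (mu : ℝ) {n : ℕ} (w : Fin n → ℝ)
    (X : Fin n → A) : A :=
  if 0 ≤ mu then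
    G.toFun n w (fun i => X i + mu • (1 : A)) - mu • (1 : A)
  else
    (G.toFun n w (fun i => (X i)⁻¹ʳ + (-mu) • (1 : A)) - (-mu) • (1 : A))⁻¹ʳ

/-! ### Power means -/

/-- The weighted geometric mean
`X #_p Y = X^{1/2} (X^{-1/2} Y X^{-1/2})^p X^{1/2}`. -/
noncomputable def wgm (p : ℝ) (X Y : A) : A :=
  X ^ (1 / 2 : ℝ) * (X ^ (-(1 / 2) : ℝ) * Y * X ^ (-(1 / 2) : ℝ)) ^ p * X ^ (1 / 2 : ℝ)

/-- The map `X ↦ ∑ᵢ wᵢ (X #_p Bᵢ)`. -/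
noncomputable def pmap {n : ℕ} (p : ℝ) (w : Fin n → ℝ) (B : Fin n → A) (X : A) : A :=
  ∑ i, w i • wgm p X (B i)

/-- `X` is a positive definite solution of the power mean equation `X = ∑ᵢ wᵢ (X #_p Bᵢ)`.
For `0 < p ≤ 1` there is exactly one, see `existsUnique_isPowerSolution`. -/
def IsPowerSolution {n : ℕ} (p : ℝ) (w : Fin n → ℝ) (B : Fin n → A) (X : A) : Prop :=
  IsStrictlyPositive X ∧ X = pmap p w B X

/-- `X` is a positive definite solution of the Karcher equation
`∑ᵢ wᵢ log (X^{1/2} Bᵢ⁻¹ X^{1/2}) = 0`.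
There is exactly one, see `existsUnique_isKarcherSolution`. -/
def IsKarcherSolution {n : ℕ} (w : Fin n → ℝ) (B : Fin n → A) (X : A) : Prop :=
  IsStrictlyPositive X ∧
    ∑ i, w i • CFC.log (X ^ (1 / 2 : ℝ) * (B i)⁻¹ʳ * X ^ (1 / 2 : ℝ)) = 0

/-- The weighted power mean `P_p(w; B)` of positive definite operators for `p ∈ [-1, 1]`: the
solution of the power mean equation for `p > 0`, the Karcher mean for `p = 0`, and
`P_{-p}(w; B⁻¹)⁻¹` for `p < 0`. -/
noncomputable def powerMean {n : ℕ} (p : ℝ) (w : Fin n → ℝ) (B : Fin n → A) : A :=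
  if 0 < p then Classical.epsilon (IsPowerSolution p w B)
  else if p = 0 then Classical.epsilon (IsKarcherSolution w B)
  else (Classical.epsilon (IsPowerSolution (-p) w (fun i => (B i)⁻¹ʳ)))⁻¹ʳ

/-- The weighted power mean of positive real numbers, that is, the generalized (Hölder) mean:
`(∑ᵢ wᵢ aᵢ^p)^{1/p}` for `p ≠ 0` and `∏ᵢ aᵢ^{wᵢ}` for `p = 0`. -/
noncomputable def scalarPowerMean {n : ℕ} (p : ℝ) (w a : Fin n → ℝ) : ℝ :=
  if p = 0 then ∏ i, a i ^ w i else (∑ i, w i * a i ^ p) ^ (1 / p)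

/-- The Kantorovich constant `(a_max + a_min)² / (4 a_max a_min)` of positive numbers
`a₁, …, aₙ`, `n ≥ 1`. -/
noncomputable def kantorovich {n : ℕ} (a : Fin n → ℝ) : ℝ :=
  ((⨆ i, a i) + (⨅ i, a i)) ^ 2 / (4 * (⨆ i, a i) * (⨅ i, a i))

/-! ### The power means are well defined

The rest of this file proves that the power mean equation and the Karcher equation have exactly one
positive definite solution, so that `powerMean` is what it should be. -/

variable {n : ℕ} {w : Fin n → ℝ} {B : Fin n → A}

theorem rpow_isSelfAdjoint (X : A) (p : ℝ) : IsSelfAdjoint (X ^ p) :=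
  (CFC.rpow_nonneg (a := X) (y := p)).isSelfAdjoint

theorem rpow_pos {X : A} (hX : IsStrictlyPositive X) (p : ℝ) : IsStrictlyPositive (X ^ p) :=
  (hX.isUnit.cfcRpow p hX.nonneg).isStrictlyPositive CFC.rpow_nonneg

theorem half_mul_half {X : A} (hX : IsStrictlyPositive X) :
    X ^ (1 / 2 : ℝ) * X ^ (1 / 2 : ℝ) = X := by
  rw [← CFC.rpow_add hX.isUnit]; norm_num; exact CFC.rpow_one X hX.nonneg

theorem half_neg {X : A} (hX : IsStrictlyPositive X) :
    X ^ (1 / 2 : ℝ) * X ^ (-(1 / 2) : ℝ) = 1 := CFC.rpow_mul_rpow_neg _ hX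

theorem neg_half {X : A} (hX : IsStrictlyPositive X) :
    X ^ (-(1 / 2) : ℝ) * X ^ (1 / 2 : ℝ) = 1 := CFC.rpow_neg_mul_rpow _ hX

/-- The congruence `X^{-1/2} Y X^{-1/2}`. -/
noncomputable def rel (X Y : A) : A := X ^ (-(1 / 2) : ℝ) * Y * X ^ (-(1 / 2) : ℝ)

theorem rel_pos {X Y : A} (hX : IsStrictlyPositive X) (hY : IsStrictlyPositive Y) :
    IsStrictlyPositive (rel X Y) :=
  IsStrictlyPositive.conjugate_of_isUnit_of_isSelfAdjoint _ _ (rpow_pos hX _).isUnit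
    (rpow_isSelfAdjoint _ _) hY

theorem rel_mono (X : A) {Y Z : A} (h : Y ≤ Z) : rel X Y ≤ rel X Z :=
  IsSelfAdjoint.conjugate_le_conjugate h (rpow_isSelfAdjoint _ _)

theorem half_rel_half {X Y : A} (hX : IsStrictlyPositive X) :
    X ^ (1 / 2 : ℝ) * rel X Y * X ^ (1 / 2 : ℝ) = Y := by
  have h1 := half_neg hX
  have h2 := neg_half hX
  unfold rel
  grind

theorem unitary_conj_rpow (U : unitary A) {M : A} (hM : IsStrictlyPositive M) (p : ℝ) :
    ((U : A) * M * star (U : A)) ^ p = (U : A) * M ^ p * star (U : A) := by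
  have hc : ContinuousOn (fun x : ℝ => x ^ p) (spectrum ℝ M) :=
    fun x hx => (Real.continuousAt_rpow_const _ _ (Or.inl (hM.spectrum_pos hx).ne')).continuousWithinAt
  have hpos : IsStrictlyPositive ((U : A) * M * star (U : A)) :=
    (Unitary.isUnit_coe (U := U)).isStrictlyPositive_star_right_conjugate_iff.mpr hM
  rw [CFC.rpow_eq_cfc_real hpos.nonneg, CFC.rpow_eq_cfc_real hM.nonneg]
  have := StarAlgHomClass.map_cfc (R := ℝ) (S := ℂ) (Unitary.conjStarAlgAut ℂ A U) (fun x : ℝ => x ^ p) M hc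
    (by
      show Continuous fun x : A => (U : A) * x * star (U : A)
      fun_prop) hM.isSelfAdjoint hpos.isSelfAdjoint
  simpa using this.symm

theorem wgm_symm_aux {R : Type*} [Monoid R] {x xi y yi m mi : R}
    (hx1 : x * xi = 1) (hx2 : xi * x = 1) (hy1 : y * yi = 1) (hy2 : yi * y = 1)
    (hm1 : m * mi = 1) (hm2 : mi * m = 1) (hm : xi * (y * y) * xi = m * m) :
    mi * (xi * y) * (y * xi * mi) = 1 ∧ y * xi * mi * (mi * (xi * y)) = 1 ∧
      y * (y * xi * mi) = x * m ∧ mi * (xi * y) * y = m * x ∧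
      yi * (x * x) * yi = (y * xi * mi) * (mi * mi) * (mi * (xi * y)) := by
  have cx1 : ∀ z, x * (xi * z) = z := fun z => by rw [← mul_assoc, hx1, one_mul]
  have cx2 : ∀ z, xi * (x * z) = z := fun z => by rw [← mul_assoc, hx2, one_mul]
  have cy1 : ∀ z, y * (yi * z) = z := fun z => by rw [← mul_assoc, hy1, one_mul]
  have cy2 : ∀ z, yi * (y * z) = z := fun z => by rw [← mul_assoc, hy2, one_mul]
  have cm1 : ∀ z, m * (mi * z) = z := fun z => by rw [← mul_assoc, hm1, one_mul]
  have cm2 : ∀ z, mi * (m * z) = z := fun z => by rw [← mul_assoc, hm2, one_mul]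
  have e3 : y * (y * xi * mi) = x * m := by
    calc y * (y * xi * mi) = x * (xi * (y * y) * xi) * mi := by simp only [mul_assoc, cx1]
      _ = x * m := by rw [hm]; simp only [mul_assoc, hm1, mul_one]
  have e4 : mi * (xi * y) * y = m * x := by
    calc mi * (xi * y) * y = mi * (xi * (y * y) * xi) * x := by
          simp only [mul_assoc, hx2, mul_one]
      _ = m * x := by rw [hm]; simp only [mul_assoc, cm2]
  have e6 : y * xi * mi * mi = yi * x := by
    calc y * xi * mi * mi = yi * (y * (y * xi * mi)) * mi := by simp only [mul_assoc, cy2]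
      _ = yi * x := by rw [e3]; simp only [mul_assoc, hm1, mul_one]
  have e7 : mi * (mi * (xi * y)) = x * yi := by
    calc mi * (mi * (xi * y)) = mi * (mi * (xi * y) * y) * yi := by
          simp only [mul_assoc, hy1, mul_one]
      _ = x * yi := by rw [e4]; simp only [mul_assoc, cm2]
  refine ⟨?_, ?_, e3, e4, ?_⟩
  · calc mi * (xi * y) * (y * xi * mi) = mi * (xi * (y * y) * xi) * mi := by
          simp only [mul_assoc]
      _ = 1 := by rw [hm]; simp only [mul_assoc, cm2, hm1]
  · calc y * xi * mi * (mi * (xi * y))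
          = yi * (y * (y * xi * mi)) * (mi * (xi * y) * y) * yi := by
          simp only [mul_assoc, cy2, hy1, mul_one]
      _ = yi * (x * (m * m) * x) * yi := by rw [e3, e4]; simp only [mul_assoc]
      _ = 1 := by rw [← hm]; simp only [mul_assoc, cx1, cx2, cy2, hy1]
  · calc yi * (x * x) * yi = (yi * x) * (x * yi) := by simp only [mul_assoc]
      _ = _ := by rw [← e6, ← e7]; simp only [mul_assoc]

theorem wgm_symm {X Y : A} (hX : IsStrictlyPositive X) (hY : IsStrictlyPositive Y) (p : ℝ) :
    wgm p X Y = wgm (1 - p) Y X := by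
  have hM := rel_pos hX hY
  have hrel : rel X Y = X ^ (-(1 / 2) : ℝ) * Y * X ^ (-(1 / 2) : ℝ) := rfl
  obtain ⟨hu1, hu2, hyu, huy, hN⟩ := wgm_symm_aux (half_neg hX) (neg_half hX) (half_neg hY)
    (neg_half hY) (half_neg hM) (neg_half hM)
    (by rw [half_mul_half hY, half_mul_half hM, hrel])
  have sx := (rpow_isSelfAdjoint X (-(1/2))).star_eq
  have sy := (rpow_isSelfAdjoint Y (1/2)).star_eq
  have sm := (rpow_isSelfAdjoint (rel X Y) (-(1/2))).star_eq
  have hp1 : rel X Y ^ p =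
      rel X Y ^ (1 / 2 : ℝ) * rel X Y ^ (p - 1) * rel X Y ^ (1 / 2 : ℝ) := by
    rw [← CFC.rpow_add hM.isUnit, ← CFC.rpow_add hM.isUnit]; congr 1; ring
  have hp2 : (rel X Y ^ (-1 : ℝ)) ^ (1 - p) = rel X Y ^ (p - 1) := by
    rw [CFC.rpow_rpow (rel X Y) _ _ (by norm_num) hM]; congr 1; ring
  have hmm1 : rel X Y ^ (-1 : ℝ) = rel X Y ^ (-(1 / 2) : ℝ) * rel X Y ^ (-(1 / 2) : ℝ) := by
    rw [← CFC.rpow_add hM.isUnit]; congr 1; ring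
  have hus : star (Y ^ (1 / 2 : ℝ) * X ^ (-(1 / 2) : ℝ) * rel X Y ^ (-(1 / 2) : ℝ))
      = rel X Y ^ (-(1 / 2) : ℝ) * (X ^ (-(1 / 2) : ℝ) * Y ^ (1 / 2 : ℝ)) := by
    simp only [star_mul, sx, sy, sm]
  let U : unitary A := ⟨Y ^ (1 / 2 : ℝ) * X ^ (-(1 / 2) : ℝ) * rel X Y ^ (-(1 / 2) : ℝ),
    Unitary.mem_iff.mpr ⟨by rw [hus]; exact hu1, by rw [hus]; exact hu2⟩⟩
  have := unitary_conj_rpow U (rpow_pos hM (-1)) (1 - p)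
  simp only [U, hus] at this
  rw [half_mul_half hX, ← hmm1] at hN
  unfold wgm
  rw [hN, this, hp2, ← hrel, hp1]
  generalize X ^ (1 / 2 : ℝ) = x at *
  generalize rel X Y ^ (1 / 2 : ℝ) = m at *
  generalize rel X Y ^ (p - 1) = q at *
  generalize X ^ (-(1 / 2) : ℝ) = xi at *
  generalize Y ^ (1 / 2 : ℝ) = y at *
  generalize rel X Y ^ (-(1 / 2) : ℝ) = mi at *
  calc x * (m * q * m) * x = (x * m) * q * (m * x) := by noncomm_ring
    _ = _ := by rw [← hyu, ← huy]; noncomm_ring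

/-- Closeness in the Thompson metric: `X` and `Y` lie within distance `t` of each other. -/
def TD (t : ℝ) (X Y : A) : Prop := X ≤ Real.exp t • Y ∧ Y ≤ Real.exp t • X

theorem TD.symm {t : ℝ} {X Y : A} (h : TD t X Y) : TD t Y X := ⟨h.2, h.1⟩

theorem le_exp_trans {s t : ℝ} {X Y Z : A} (h : X ≤ Real.exp s • Y) (h' : Y ≤ Real.exp t • Z) :
    X ≤ Real.exp (s + t) • Z := by
  refine h.trans ?_
  rw [Real.exp_add, mul_smul]
  exact smul_le_smul_of_nonneg_left h' (Real.exp_pos s).le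

theorem TD.trans {s t : ℝ} {X Y Z : A} (h : TD s X Y) (h' : TD t Y Z) : TD (s + t) X Z :=
  ⟨le_exp_trans h.1 h'.1, by rw [add_comm]; exact le_exp_trans h'.2 h.2⟩

theorem TD.mono {s t : ℝ} {X Y : A} (hX : 0 ≤ X) (hY : 0 ≤ Y) (h : TD s X Y) (hst : s ≤ t) :
    TD t X Y :=
  ⟨h.1.trans (smul_le_smul_of_nonneg_right (Real.exp_le_exp.mpr hst) hY),
    h.2.trans (smul_le_smul_of_nonneg_right (Real.exp_le_exp.mpr hst) hX)⟩

open Filter Topology in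
theorem TD.tendsto {X Y : ℕ → A} {a : ℕ → ℝ} {X' Y' : A} {b : ℝ}
    (hX : Tendsto X atTop (𝓝 X')) (hY : Tendsto Y atTop (𝓝 Y')) (ha : Tendsto a atTop (𝓝 b))
    (h : ∀ᶠ n in atTop, TD (a n) (X n) (Y n)) : TD b X' Y' :=
  ⟨le_of_tendsto_of_tendsto hX (((Real.continuous_exp.tendsto b).comp ha).smul hY)
      (h.mono fun _ hn => hn.1),
    le_of_tendsto_of_tendsto hY (((Real.continuous_exp.tendsto b).comp ha).smul hX)
      (h.mono fun _ hn => hn.2)⟩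

theorem TD.eq_of_zero {X Y : A} (h : TD 0 X Y) : X = Y := by
  obtain ⟨h1, h2⟩ := h
  rw [Real.exp_zero, one_smul] at h1 h2
  exact le_antisymm h1 h2

theorem le_smul_of_rel_le {X Y : A} {c : ℝ} (hY : IsStrictlyPositive Y)
    (h : rel Y X ≤ c • (1 : A)) : X ≤ c • Y := by
  have := IsSelfAdjoint.conjugate_le_conjugate h (rpow_isSelfAdjoint Y (1 / 2))
  rwa [half_rel_half hY, mul_smul_comm, smul_mul_assoc, mul_one, half_mul_half hY] at this

theorem rel_smul (X Y : A) (c : ℝ) : rel X (c • Y) = c • rel X Y := by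
  simp [rel]

theorem rel_self {X : A} (hX : IsStrictlyPositive X) : rel X X = 1 :=
  CFC.conjugate_rpow_neg_one_half X hX

theorem rel_le_of_le_smul {X Y : A} {c : ℝ} (hY : IsStrictlyPositive Y)
    (h : X ≤ c • Y) : rel Y X ≤ c • (1 : A) := by
  have := rel_mono Y h
  rwa [rel_smul, rel_self hY] at this

theorem smul_le_rel_of_smul_le {X Y : A} {c : ℝ} (hY : IsStrictlyPositive Y)
    (h : c • Y ≤ X) : c • (1 : A) ≤ rel Y X := by
  have := rel_mono Y h
  rwa [rel_smul, rel_self hY] at this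

theorem exists_TD {X Y : A} (hX : IsStrictlyPositive X) (hY : IsStrictlyPositive Y) :
    ∃ t : ℝ, 0 ≤ t ∧ TD t X Y := by
  have key : ∀ X Y : A, IsStrictlyPositive X → IsStrictlyPositive Y →
      X ≤ Real.exp ‖rel Y X‖ • Y := by
    intro X Y hX hY
    refine le_smul_of_rel_le hY ?_
    refine ((rel_pos hY hX).isSelfAdjoint.le_algebraMap_norm_self).trans ?_
    rw [Algebra.algebraMap_eq_smul_one]
    refine smul_le_smul_of_nonneg_right ?_ zero_le_one
    linarith [Real.add_one_le_exp ‖rel Y X‖]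
  refine ⟨max ‖rel Y X‖ ‖rel X Y‖, le_max_of_le_left (norm_nonneg _), ?_, ?_⟩
  · exact (key X Y hX hY).trans
      (smul_le_smul_of_nonneg_right (Real.exp_le_exp.mpr (le_max_left _ _)) hY.nonneg)
  · exact (key Y X hY hX).trans
      (smul_le_smul_of_nonneg_right (Real.exp_le_exp.mpr (le_max_right _ _)) hX.nonneg)

theorem TD.norm_sub_le {t M : ℝ} (ht : 0 ≤ t) {X Y : A} (h : TD t X Y)
    (hX : X ≤ M • (1 : A)) (hY : Y ≤ M • (1 : A)) (hM : 0 ≤ M) (hX0 : 0 ≤ X) (hY0 : 0 ≤ Y) :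
    ‖X - Y‖ ≤ (Real.exp t - 1) * M := by
  have he : 0 ≤ Real.exp t - 1 := by linarith [Real.add_one_le_exp t]
  have key : ∀ X Y : A, X ≤ Real.exp t • Y → Y ≤ M • (1 : A) →
      X - Y ≤ ((Real.exp t - 1) * M) • (1 : A) := by
    intro X Y h hY
    calc X - Y ≤ Real.exp t • Y - Y := sub_le_sub_right h _
      _ = (Real.exp t - 1) • Y := by rw [sub_smul, one_smul]
      _ ≤ (Real.exp t - 1) • (M • (1 : A)) := smul_le_smul_of_nonneg_left hY he
      _ = _ := by rw [mul_smul]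
  have h1 := key X Y h.1 hY
  have h2 := key Y X h.2 hX
  have hsa : IsSelfAdjoint (X - Y) := hX0.isSelfAdjoint.sub hY0.isSelfAdjoint
  have hr : 0 ≤ (Real.exp t - 1) * M := mul_nonneg he hM
  rcases subsingleton_or_nontrivial A with hA | hA
  · rw [Subsingleton.elim (X - Y) 0, norm_zero]; exact hr
  rcases CStarAlgebra.norm_or_neg_norm_mem_spectrum hsa with h | h
  · rw [← Algebra.algebraMap_eq_smul_one, le_algebraMap_iff_spectrum_le (ha := hsa)] at h1
    exact h1 _ h
  · have h3 : -(((Real.exp t - 1) * M) • (1 : A)) ≤ X - Y := by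
      rw [neg_le, neg_sub]; exact h2
    rw [← neg_smul, ← Algebra.algebraMap_eq_smul_one, algebraMap_le_iff_le_spectrum (ha := hsa)]
      at h3
    have := h3 _ h
    linarith

open Filter Topology in
theorem TD.exists_limit {X : ℕ → A} {b : ℕ → ℝ} (hX : ∀ n, IsStrictlyPositive (X n))
    (hb0 : ∀ n, 0 ≤ b n) (hb : Tendsto b atTop (𝓝 0))
    (h : ∀ n m, n ≤ m → TD (b n) (X n) (X m)) :
    ∃ X' : A, IsStrictlyPositive X' ∧ Tendsto X atTop (𝓝 X') ∧ ∀ n, TD (b n) (X n) X' := by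
  obtain ⟨T, hT0, hT⟩ := exists_TD (hX 0) (isStrictlyPositive_one (A := A))
  have hbd : ∀ n, X n ≤ Real.exp (b 0 + T) • (1 : A) := fun n =>
    ((h 0 n (Nat.zero_le n)).symm.trans hT).1
  have hM : 0 ≤ Real.exp (b 0 + T) := (Real.exp_pos _).le
  have hc : CauchySeq X := by
    refine cauchySeq_of_le_tendsto_0 (fun n => 2 * ((Real.exp (b n) - 1) * Real.exp (b 0 + T))) ?_ ?_
    · intro n m N hn hm
      have h1 := (h N n hn).norm_sub_le (hb0 N) (hbd N) (hbd n) hM (hX N).nonneg (hX n).nonneg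
      have h2 := (h N m hm).norm_sub_le (hb0 N) (hbd N) (hbd m) hM (hX N).nonneg (hX m).nonneg
      rw [← dist_eq_norm] at h1 h2
      calc dist (X n) (X m) ≤ dist (X n) (X N) + dist (X N) (X m) := dist_triangle _ _ _
        _ ≤ _ := by rw [dist_comm (X n)]; linarith
    · have : Tendsto (fun n => 2 * ((Real.exp (b n) - 1) * Real.exp (b 0 + T))) atTop
          (𝓝 (2 * ((Real.exp 0 - 1) * Real.exp (b 0 + T)))) :=
        ((((Real.continuous_exp.tendsto 0).comp hb).sub_const 1).mul_const _).const_mul 2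
      simpa using this
  obtain ⟨X', hX'⟩ := cauchySeq_tendsto_of_complete hc
  have hTD : ∀ n, TD (b n) (X n) X' := fun n =>
    TD.tendsto tendsto_const_nhds hX' tendsto_const_nhds
      ((eventually_ge_atTop n).mono fun m hm => h n m hm)
  refine ⟨X', ?_, hX', hTD⟩
  have h0 := (hTD 0).1
  have h1 : Real.exp (-(b 0)) • X 0 ≤ X' := by
    calc Real.exp (-(b 0)) • X 0 ≤ Real.exp (-(b 0)) • (Real.exp (b 0) • X') :=
          smul_le_smul_of_nonneg_left h0 (Real.exp_pos _).le
      _ = X' := by rw [smul_smul, ← Real.exp_add]; simp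
  exact (IsStrictlyPositive.smul (Real.exp_pos _) (hX 0)).of_le h1

theorem smul_rpow {a : A} (ha : IsStrictlyPositive a) {c : ℝ} (hc : 0 < c) (p : ℝ) :
    (c • a) ^ p = c ^ p • a ^ p := by
  have hcont : ContinuousOn (fun x : ℝ => x ^ p) (spectrum ℝ a) :=
    fun x hx => (Real.continuousAt_rpow_const _ _ (Or.inl (ha.spectrum_pos hx).ne')).continuousWithinAt
  have hcont' : ContinuousOn (fun x : ℝ => x ^ p) ((c * ·) '' spectrum ℝ a) := by
    rintro _ ⟨x, hx, rfl⟩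
    exact (Real.continuousAt_rpow_const _ _
      (Or.inl (mul_pos hc (ha.spectrum_pos hx)).ne')).continuousWithinAt
  rw [CFC.rpow_eq_cfc_real (ha.smul hc).nonneg, CFC.rpow_eq_cfc_real ha.nonneg,
    ← cfc_comp_const_mul c (fun x : ℝ => x ^ p) a hcont' ha.isSelfAdjoint,
    ← cfc_smul (c ^ p) (fun x : ℝ => x ^ p) a hcont]
  refine cfc_congr fun x hx => ?_
  simp [Real.mul_rpow hc.le (ha.spectrum_pos hx).le]

theorem wgm_le_of_le {p c : ℝ} (hp0 : 0 ≤ p) (hp1 : p ≤ 1) (hc : 0 < c) {X Y Z : A}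
    (hX : IsStrictlyPositive X) (hY : IsStrictlyPositive Y) (hZ : IsStrictlyPositive Z)
    (h : X ≤ c • Y) : wgm p X Z ≤ c ^ (1 - p) • wgm p Y Z := by
  rw [wgm_symm hX hZ, wgm_symm hY hZ]
  have h1 : rel Z X ≤ c • rel Z Y := by rw [← rel_smul]; exact rel_mono Z h
  have h2 : rel Z X ^ (1 - p) ≤ (c • rel Z Y) ^ (1 - p) :=
    CFC.rpow_le_rpow ⟨by linarith, by linarith⟩ h1
  rw [smul_rpow (rel_pos hZ hY) hc] at h2
  have := IsSelfAdjoint.conjugate_le_conjugate h2 (rpow_isSelfAdjoint Z (1 / 2))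
  rwa [mul_smul_comm, smul_mul_assoc] at this

theorem wgm_pos {p : ℝ} {X Y : A} (hX : IsStrictlyPositive X) (hY : IsStrictlyPositive Y) :
    IsStrictlyPositive (wgm p X Y) :=
  IsStrictlyPositive.conjugate_of_isUnit_of_isSelfAdjoint _ _ (rpow_pos hX _).isUnit
    (rpow_isSelfAdjoint _ _) (rpow_pos (rel_pos hX hY) p)


theorem sum_pos (hw : w ∈ stdSimplex ℝ (Fin n)) {C : Fin n → A}
    (hC : ∀ i, IsStrictlyPositive (C i)) : IsStrictlyPositive (∑ i, w i • C i) := by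
  obtain ⟨hw0, hw1⟩ := hw
  have : ∃ i, 0 < w i := by
    by_contra hcon
    push Not at hcon
    have := Finset.sum_nonpos (s := Finset.univ) fun i _ => hcon i
    linarith
  obtain ⟨i, hi⟩ := this
  refine ((hC i).smul hi).of_le ?_
  exact Finset.single_le_sum (f := fun i => w i • C i)
    (fun j _ => smul_nonneg (hw0 j) (hC j).nonneg) (Finset.mem_univ i)

theorem pmap_pos (hw : w ∈ stdSimplex ℝ (Fin n)) (hB : ∀ i, IsStrictlyPositive (B i)) {p : ℝ}
    {X : A} (hX : IsStrictlyPositive X) : IsStrictlyPositive (pmap p w B X) :=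
  sum_pos hw fun i => wgm_pos hX (hB i)

theorem pmap_TD (hw : w ∈ stdSimplex ℝ (Fin n)) (hB : ∀ i, IsStrictlyPositive (B i)) {p t : ℝ}
    (hp0 : 0 ≤ p) (hp1 : p ≤ 1) {X Y : A} (hX : IsStrictlyPositive X) (hY : IsStrictlyPositive Y)
    (h : TD t X Y) : TD ((1 - p) * t) (pmap p w B X) (pmap p w B Y) := by
  have key : ∀ X Y : A, IsStrictlyPositive X → IsStrictlyPositive Y → X ≤ Real.exp t • Y →
      pmap p w B X ≤ Real.exp ((1 - p) * t) • pmap p w B Y := by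
    intro X Y hX hY h
    unfold pmap
    rw [Finset.smul_sum]
    refine Finset.sum_le_sum fun i _ => ?_
    rw [smul_comm]
    refine smul_le_smul_of_nonneg_left ?_ (hw.1 i)
    have := wgm_le_of_le hp0 hp1 (Real.exp_pos t) hX hY (hB i) h
    rwa [← Real.exp_mul, mul_comm] at this
  exact ⟨key X Y hX hY h.1, key Y X hY hX h.2⟩

open Filter Topology in
theorem pmap_exists (hw : w ∈ stdSimplex ℝ (Fin n)) (hB : ∀ i, IsStrictlyPositive (B i)) {p ε : ℝ}
    (hp0 : 0 < p) (hp1 : p ≤ 1) (hε : 0 ≤ ε) {X₀ : A} (hX₀ : IsStrictlyPositive X₀)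
    (h : TD (p * ε) X₀ (pmap p w B X₀)) :
    ∃ X : A, IsStrictlyPositive X ∧ pmap p w B X = X ∧ TD ε X₀ X := by
  have hq0 : 0 ≤ 1 - p := by linarith
  let X : ℕ → A := fun k => (pmap p w B)^[k] X₀
  have hsucc : ∀ k, X (k + 1) = pmap p w B (X k) := fun k =>
    Function.iterate_succ_apply' _ _ _
  have hpos : ∀ k, IsStrictlyPositive (X k) := by
    intro k
    induction k with
    | zero => exact hX₀
    | succ k ih => rw [hsucc]; exact pmap_pos hw hB ih
  have hstep : ∀ k, TD ((1 - p) ^ k * (p * ε)) (X k) (X (k + 1)) := by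
    intro k
    induction k with
    | zero => simpa [X] using h
    | succ k ih =>
      have := pmap_TD hw hB hp0.le hp1 (hpos k) (hpos (k + 1)) ih
      rw [← hsucc, ← hsucc] at this
      rw [pow_succ', mul_assoc]; exact this
  have hchain : ∀ k m, TD (ε * ((1 - p) ^ k - (1 - p) ^ (k + m))) (X k) (X (k + m)) := by
    intro k m
    induction m with
    | zero => simp [TD]
    | succ m ih =>
      have := ih.trans (hstep (k + m))
      have e : ε * ((1 - p) ^ k - (1 - p) ^ (k + (m + 1))) =
          ε * ((1 - p) ^ k - (1 - p) ^ (k + m)) + (1 - p) ^ (k + m) * (p * ε) := by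
        rw [← add_assoc, pow_succ (1 - p) (k + m)]; ring
      rw [e]; exact this
  have hlim : Tendsto (fun k => ε * (1 - p) ^ k) atTop (𝓝 0) := by
    simpa using (tendsto_pow_atTop_nhds_zero_of_lt_one hq0 (by linarith)).const_mul ε
  obtain ⟨X', hX'pos, hX', hTD⟩ := TD.exists_limit (b := fun k => ε * (1 - p) ^ k) hpos
    (fun k => mul_nonneg hε (pow_nonneg hq0 k)) hlim (by
      intro k m hkm
      obtain ⟨j, rfl⟩ := Nat.exists_eq_add_of_le hkm
      refine (hchain k j).mono (hpos _).nonneg (hpos _).nonneg ?_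
      exact mul_le_mul_of_nonneg_left (by linarith [pow_nonneg hq0 (k + j)]) hε)
  refine ⟨X', hX'pos, ?_, by simpa [X] using hTD 0⟩
  symm
  apply TD.eq_of_zero
  refine TD.tendsto (hX'.comp (tendsto_add_atTop_nat 1)) tendsto_const_nhds
    (a := fun k => (1 - p) * (ε * (1 - p) ^ k)) (by simpa using hlim.const_mul (1 - p)) ?_
  refine Eventually.of_forall fun k => ?_
  show TD _ (X (k + 1)) _
  rw [hsucc]
  exact pmap_TD hw hB hp0.le hp1 (hpos k) hX'pos (hTD k)

open Filter Topology in
theorem pmap_unique (hw : w ∈ stdSimplex ℝ (Fin n)) (hB : ∀ i, IsStrictlyPositive (B i)) {p : ℝ}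
    (hp0 : 0 < p) (hp1 : p ≤ 1) {X Y : A} (hX : IsStrictlyPositive X) (hY : IsStrictlyPositive Y)
    (hXf : pmap p w B X = X) (hYf : pmap p w B Y = Y) : X = Y := by
  obtain ⟨t, -, ht⟩ := exists_TD hX hY
  have hk : ∀ k : ℕ, TD ((1 - p) ^ k * t) X Y := by
    intro k
    induction k with
    | zero => simpa using ht
    | succ k ih =>
      have := pmap_TD hw hB hp0.le hp1 hX hY ih
      rw [hXf, hYf] at this
      rw [pow_succ', mul_assoc]; exact this
  apply TD.eq_of_zero
  refine TD.tendsto tendsto_const_nhds tendsto_const_nhds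
    (a := fun k : ℕ => (1 - p) ^ k * t) ?_ (Eventually.of_forall hk)
  simpa using (tendsto_pow_atTop_nhds_zero_of_lt_one (by linarith : 0 ≤ 1 - p)
    (by linarith)).mul_const t

theorem op_nonneg {T : A} (hT : IsStrictlyPositive T) {a p d q b c : ℝ}
    (h : ∀ x ∈ spectrum ℝ T, 0 ≤ a * x ^ p + d * x ^ q + b * Real.log x + c) :
    0 ≤ a • T ^ p + d • T ^ q + b • CFC.log T + c • (1 : A) := by
  have hr : ∀ r : ℝ, ContinuousOn (fun x : ℝ => x ^ r) (spectrum ℝ T) := fun r x hx =>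
    (Real.continuousAt_rpow_const _ _ (Or.inl (hT.spectrum_pos hx).ne')).continuousWithinAt
  have hl : ContinuousOn Real.log (spectrum ℝ T) := fun x hx =>
    (Real.continuousAt_log (hT.spectrum_pos hx).ne').continuousWithinAt
  have hsa := hT.isSelfAdjoint
  have key : cfc (fun x : ℝ => a * x ^ p + d * x ^ q + b * Real.log x + c) T =
      a • T ^ p + d • T ^ q + b • CFC.log T + c • (1 : A) := by
    have h1 : ContinuousOn (fun x : ℝ => a * x ^ p) (spectrum ℝ T) :=
      continuousOn_const.mul (hr p)
    have h2 : ContinuousOn (fun x : ℝ => d * x ^ q) (spectrum ℝ T) :=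
      continuousOn_const.mul (hr q)
    have h3 : ContinuousOn (fun x : ℝ => b * Real.log x) (spectrum ℝ T) :=
      continuousOn_const.mul hl
    rw [cfc_add (R := ℝ) T (fun x : ℝ => a * x ^ p + d * x ^ q + b * Real.log x) (fun _ => c)
        ((h1.add h2).add h3) continuousOn_const,
      cfc_add (R := ℝ) T (fun x : ℝ => a * x ^ p + d * x ^ q) (fun x => b * Real.log x)
        (h1.add h2) h3,
      cfc_add (R := ℝ) T (fun x : ℝ => a * x ^ p) (fun x => d * x ^ q) h1 h2,
      cfc_const_mul a (fun x : ℝ => x ^ p) T (hr p), cfc_const_mul d (fun x : ℝ => x ^ q) T (hr q),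
      cfc_const_mul b Real.log T hl, cfc_const c T hsa, CFC.rpow_eq_cfc_real hT.nonneg,
      CFC.rpow_eq_cfc_real hT.nonneg, Algebra.algebraMap_eq_smul_one, CFC.log]
  rw [← key]
  exact cfc_nonneg h

theorem sum_op_nonneg (hw : w ∈ stdSimplex ℝ (Fin n)) {T : Fin n → A}
    (hT : ∀ i, IsStrictlyPositive (T i)) {a p d q b c : ℝ}
    (h : ∀ i, ∀ x ∈ spectrum ℝ (T i), 0 ≤ a * x ^ p + d * x ^ q + b * Real.log x + c) :
    0 ≤ a • (∑ i, w i • T i ^ p) + d • (∑ i, w i • T i ^ q) + b • (∑ i, w i • CFC.log (T i))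
      + c • (1 : A) := by
  have h1 : 0 ≤ ∑ i, w i • (a • T i ^ p + d • T i ^ q + b • CFC.log (T i) + c • (1 : A)) :=
    Finset.sum_nonneg fun i _ => smul_nonneg (hw.1 i) (op_nonneg (hT i) (h i))
  convert h1 using 1
  simp only [smul_add, Finset.sum_add_distrib, Finset.smul_sum]
  simp only [smul_comm (w _) a, smul_comm (w _) b, smul_comm (w _) c, smul_comm (w _) d]
  congr 1
  rw [← Finset.smul_sum, ← Finset.sum_smul, hw.2, one_smul]

theorem pmap_eq (p : ℝ) (X : A) :
    pmap p w B X = X ^ (1 / 2 : ℝ) * (∑ i, w i • rel X (B i) ^ p) * X ^ (1 / 2 : ℝ) := by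
  simp only [pmap, wgm, rel, Finset.mul_sum, Finset.sum_mul, mul_smul_comm, smul_mul_assoc]

theorem rel_half {X S : A} (hX : IsStrictlyPositive X) :
    rel X (X ^ (1 / 2 : ℝ) * S * X ^ (1 / 2 : ℝ)) = S := by
  unfold rel
  calc X ^ (-(1 / 2) : ℝ) * (X ^ (1 / 2 : ℝ) * S * X ^ (1 / 2 : ℝ)) * X ^ (-(1 / 2) : ℝ)
      = (X ^ (-(1 / 2) : ℝ) * X ^ (1 / 2 : ℝ)) * S * (X ^ (1 / 2 : ℝ) * X ^ (-(1 / 2) : ℝ)) := by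
        simp only [mul_assoc]
    _ = S := by rw [half_neg hX, neg_half hX, one_mul, mul_one]

theorem rel_pmap {p : ℝ} {X : A} (hX : IsStrictlyPositive X) :
    rel X (pmap p w B X) = ∑ i, w i • rel X (B i) ^ p := by
  rw [pmap_eq, rel_half hX]

theorem log_abs_le {R : ℝ} {X Y : A} (hX : IsStrictlyPositive X) (hY : IsStrictlyPositive Y)
    (h : TD R Y X) {x : ℝ} (hx : x ∈ spectrum ℝ (rel X Y)) : |Real.log x| ≤ R := by
  have hsa := (rel_pos hX hY).isSelfAdjoint
  have hx0 := (rel_pos hX hY).spectrum_pos hx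
  have h1 := rel_le_of_le_smul hX h.1
  have h2 : Real.exp (-R) • X ≤ Y := by
    calc Real.exp (-R) • X ≤ Real.exp (-R) • (Real.exp R • Y) :=
          smul_le_smul_of_nonneg_left h.2 (Real.exp_pos _).le
      _ = Y := by rw [smul_smul, ← Real.exp_add]; simp
  have h3 := smul_le_rel_of_smul_le hX h2
  rw [← Algebra.algebraMap_eq_smul_one, le_algebraMap_iff_spectrum_le (ha := hsa)] at h1
  rw [← Algebra.algebraMap_eq_smul_one, algebraMap_le_iff_le_spectrum (ha := hsa)] at h3
  rw [abs_le]
  exact ⟨(Real.le_log_iff_exp_le hx0).mpr (h3 x hx), (Real.log_le_iff_le_exp hx0).mpr (h1 x hx)⟩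

theorem rpow_upper {x p R : ℝ} (hx : 0 < x) (hp : 0 ≤ p) (hlog : |Real.log x| ≤ R)
    (hpR : p * R ≤ 1) : x ^ p ≤ 1 + p * Real.log x + (p * R) ^ 2 := by
  have h1 : |p * Real.log x| ≤ p * R := by
    rw [abs_mul, abs_of_nonneg hp]; exact mul_le_mul_of_nonneg_left hlog hp
  have h2 := Real.abs_exp_sub_one_sub_id_le (h1.trans hpR)
  have h3 : (p * Real.log x) ^ 2 ≤ (p * R) ^ 2 := sq_le_sq' (by linarith [(abs_le.mp h1).1])
    (abs_le.mp h1).2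
  rw [Real.rpow_def_of_pos hx, mul_comm (Real.log x)]
  linarith [(abs_le.mp h2).2]

theorem rpow_lower {x p : ℝ} (hx : 0 < x) : 1 + p * Real.log x ≤ x ^ p := by
  rw [Real.rpow_def_of_pos hx, mul_comm (Real.log x)]
  linarith [Real.add_one_le_exp (p * Real.log x)]

theorem rpow_bern {x p q : ℝ} (hx : 0 < x) (hq : 0 < q) (hqp : q ≤ p) :
    1 + p / q * (x ^ q - 1) ≤ x ^ p := by
  have h := one_add_mul_self_le_rpow_one_add (s := x ^ q - 1) (p := p / q)
    (by linarith [Real.rpow_pos_of_pos hx q]) ((one_le_div hq).mpr hqp)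
  rw [add_sub_cancel, ← Real.rpow_mul hx.le, mul_div_cancel₀ _ hq.ne'] at h
  exact h

theorem pmap_near (hw : w ∈ stdSimplex ℝ (Fin n)) (hB : ∀ i, IsStrictlyPositive (B i)) {p R : ℝ}
    (hp0 : 0 < p) (hpR : p * R ≤ 1) {X : A} (hX : IsStrictlyPositive X)
    (hR : ∀ i, TD R (B i) X)
    (h1 : ∑ i, w i • CFC.log (rel X (B i)) ≤ 0) (h2 : 1 ≤ ∑ i, w i • rel X (B i) ^ p) :
    TD (p * (p * R ^ 2)) X (pmap p w B X) := by
  have hT : ∀ i, IsStrictlyPositive (rel X (B i)) := fun i => rel_pos hX (hB i)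
  have hup := sum_op_nonneg (a := -1) (p := p) (d := 0) (q := 0) (b := p) (c := 1 + (p * R) ^ 2)
    hw hT (by
      intro i x hx
      have := rpow_upper ((hT i).spectrum_pos hx) hp0.le (log_abs_le hX (hB i) (hR i) hx) hpR
      linarith)
  have hS : ∑ i, w i • rel X (B i) ^ p ≤ (1 + (p * R) ^ 2) • (1 : A) := by
    have h3 : p • ∑ i, w i • CFC.log (rel X (B i)) ≤ 0 := smul_nonpos_of_nonneg_of_nonpos hp0.le h1
    have h4 : 0 ≤ -(∑ i, w i • rel X (B i) ^ p) + (1 + (p * R) ^ 2) • (1 : A)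
        + p • ∑ i, w i • CFC.log (rel X (B i)) := by
      convert hup using 1
      simp only [neg_smul, one_smul, zero_smul, add_zero]
      abel
    have h5 := h4.trans (add_le_add_right h3 _)
    rw [add_zero, neg_add_eq_sub] at h5
    exact sub_nonneg.mp h5
  constructor
  · have h5 : rel (pmap p w B X) X = rel (pmap p w B X) X := rfl
    have h6 : X ≤ pmap p w B X := by
      have := IsSelfAdjoint.conjugate_le_conjugate h2 (rpow_isSelfAdjoint X (1 / 2))
      rwa [mul_one, half_mul_half hX, ← pmap_eq] at this
    refine h6.trans ?_
    have : (1 : ℝ) • pmap p w B X ≤ Real.exp (p * (p * R ^ 2)) • pmap p w B X :=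
      smul_le_smul_of_nonneg_right (Real.one_le_exp (by positivity)) (pmap_pos hw hB hX).nonneg
    rwa [one_smul] at this
  · refine le_smul_of_rel_le hX ?_
    rw [rel_pmap hX]
    refine hS.trans (smul_le_smul_of_nonneg_right ?_ zero_le_one)
    have := Real.add_one_le_exp (p * (p * R ^ 2))
    calc 1 + (p * R) ^ 2 = p * (p * R ^ 2) + 1 := by ring
      _ ≤ _ := this

theorem sum_log_le_zero (hw : w ∈ stdSimplex ℝ (Fin n)) (hB : ∀ i, IsStrictlyPositive (B i))
    {q : ℝ} (hq : 0 < q) {X : A} (hX : IsStrictlyPositive X) (hf : pmap q w B X = X) :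
    ∑ i, w i • CFC.log (rel X (B i)) ≤ 0 := by
  have hT : ∀ i, IsStrictlyPositive (rel X (B i)) := fun i => rel_pos hX (hB i)
  have hS : ∑ i, w i • rel X (B i) ^ q = 1 := by rw [← rel_pmap hX, hf, rel_self hX]
  have h := sum_op_nonneg (a := 1) (p := q) (d := 0) (q := 0) (b := -q) (c := -1) hw hT (by
      intro i x hx
      have := rpow_lower (p := q) ((hT i).spectrum_pos hx)
      linarith)
  rw [hS] at h
  have h' : 0 ≤ -(q • ∑ i, w i • CFC.log (rel X (B i))) := by
    convert h using 1
    simp only [neg_smul, one_smul, zero_smul, add_zero]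
    abel
  have h'' := smul_nonpos_of_nonneg_of_nonpos (inv_pos.mpr hq).le (neg_nonneg.mp h')
  rwa [smul_smul, inv_mul_cancel₀ hq.ne', one_smul] at h''

theorem one_le_sum_rpow (hw : w ∈ stdSimplex ℝ (Fin n)) (hB : ∀ i, IsStrictlyPositive (B i))
    {p q : ℝ} (hq : 0 < q) (hqp : q ≤ p) {X : A} (hX : IsStrictlyPositive X)
    (hf : pmap q w B X = X) : 1 ≤ ∑ i, w i • rel X (B i) ^ p := by
  have hT : ∀ i, IsStrictlyPositive (rel X (B i)) := fun i => rel_pos hX (hB i)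
  have hS : ∑ i, w i • rel X (B i) ^ q = 1 := by rw [← rel_pmap hX, hf, rel_self hX]
  have h := sum_op_nonneg (a := 1) (p := p) (d := -(p / q)) (q := q) (b := 0) (c := p / q - 1)
    hw hT (by
      intro i x hx
      have := rpow_bern ((hT i).spectrum_pos hx) hq hqp
      linarith)
  rw [hS] at h
  rw [← sub_nonneg]
  convert h using 1
  simp only [neg_smul, one_smul, zero_smul, add_zero, sub_smul]
  abel

theorem one_le_sum_rpow' (hw : w ∈ stdSimplex ℝ (Fin n)) (hB : ∀ i, IsStrictlyPositive (B i))
    {p : ℝ} {X : A} (hX : IsStrictlyPositive X)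
    (hf : ∑ i, w i • CFC.log (rel X (B i)) = 0) : 1 ≤ ∑ i, w i • rel X (B i) ^ p := by
  have hT : ∀ i, IsStrictlyPositive (rel X (B i)) := fun i => rel_pos hX (hB i)
  have h := sum_op_nonneg (a := 1) (p := p) (d := 0) (q := 0) (b := -p) (c := -1)
    hw hT (by
      intro i x hx
      have := rpow_lower (p := p) ((hT i).spectrum_pos hx)
      linarith)
  rw [hf] at h
  rw [← sub_nonneg]
  convert h using 1
  simp only [neg_smul, one_smul, zero_smul, smul_zero, add_zero]
  abel

theorem exists_TD_all {ι : Type*} [Finite ι] {B : ι → A} (hB : ∀ i, IsStrictlyPositive (B i))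
    {X : A} (hX : IsStrictlyPositive X) : ∃ t : ℝ, 0 ≤ t ∧ ∀ i, TD t (B i) X := by
  have := Fintype.ofFinite ι
  choose t ht0 ht using fun i => exists_TD (hB i) hX
  refine ⟨∑ i, t i, Finset.sum_nonneg fun i _ => ht0 i, fun i => ?_⟩
  exact (ht i).mono (hB i).nonneg hX.nonneg
    (Finset.single_le_sum (fun j _ => ht0 j) (Finset.mem_univ i))

theorem pmap_one_TD (hw : w ∈ stdSimplex ℝ (Fin n)) {p M : ℝ}
    (hp0 : 0 ≤ p) (hp1 : p ≤ 1) (hM : ∀ i, TD M (B i) 1) :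
    TD (p * M) (1 : A) (pmap p w B 1) := by
  have hpe : ∀ c : ℝ, (Real.exp c • (1 : A)) ^ p = Real.exp (p * c) • (1 : A) := fun c => by
    rw [smul_rpow isStrictlyPositive_one (Real.exp_pos c), CFC.one_rpow, ← Real.exp_mul, mul_comm]
  have hs : ∀ c : ℝ, ∑ i, w i • (c • (1 : A)) = c • (1 : A) := fun c => by
    rw [← Finset.sum_smul, hw.2, one_smul]
  have hpm : pmap p w B 1 = ∑ i, w i • (B i) ^ p := by simp [pmap, wgm]
  rw [hpm]
  constructor
  · have : Real.exp (p * (-M)) • (1 : A) ≤ ∑ i, w i • (B i) ^ p := by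
      rw [← hs]
      refine Finset.sum_le_sum fun i _ => smul_le_smul_of_nonneg_left ?_ (hw.1 i)
      rw [← hpe]
      refine CFC.rpow_le_rpow ⟨hp0, hp1⟩ ?_
      calc Real.exp (-M) • (1 : A) ≤ Real.exp (-M) • (Real.exp M • B i) :=
            smul_le_smul_of_nonneg_left (hM i).2 (Real.exp_pos _).le
        _ = B i := by rw [smul_smul, ← Real.exp_add]; simp
    calc (1 : A) = Real.exp (p * M) • (Real.exp (p * (-M)) • (1 : A)) := by
          rw [smul_smul, ← Real.exp_add]; simp
      _ ≤ _ := smul_le_smul_of_nonneg_left this (Real.exp_pos _).le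
  · rw [← hs]
    refine Finset.sum_le_sum fun i _ => smul_le_smul_of_nonneg_left ?_ (hw.1 i)
    rw [← hpe]
    exact CFC.rpow_le_rpow ⟨hp0, hp1⟩ (hM i).1

theorem power_exists (hw : w ∈ stdSimplex ℝ (Fin n)) (hB : ∀ i, IsStrictlyPositive (B i)) {p M : ℝ}
    (hp0 : 0 < p) (hp1 : p ≤ 1) (hM0 : 0 ≤ M) (hM : ∀ i, TD M (B i) 1) :
    ∃ X : A, IsStrictlyPositive X ∧ pmap p w B X = X ∧ TD M 1 X :=
  pmap_exists hw hB hp0 hp1 hM0 isStrictlyPositive_one (pmap_one_TD hw hp0.le hp1 hM)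

/-- A sequence of exponents in `(0, 1]` that decreases to zero. -/
noncomputable def expo (R : ℝ) (k : ℕ) : ℝ := 1 / (k + 1 + R)

theorem expo_pos {R : ℝ} (hR : 0 ≤ R) (k : ℕ) : 0 < expo R k := by unfold expo; positivity

theorem expo_le_one {R : ℝ} (hR : 0 ≤ R) (k : ℕ) : expo R k ≤ 1 := by
  unfold expo; rw [div_le_one (by positivity)]; linarith [(Nat.cast_nonneg k : (0 : ℝ) ≤ k)]

theorem expo_mul_le {R : ℝ} (hR : 0 ≤ R) (k : ℕ) : expo R k * R ≤ 1 := by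
  unfold expo; rw [one_div_mul_eq_div, div_le_one (by positivity)]
  linarith [(Nat.cast_nonneg k : (0 : ℝ) ≤ k)]

theorem expo_anti {R : ℝ} (hR : 0 ≤ R) {k m : ℕ} (h : k ≤ m) : expo R m ≤ expo R k := by
  unfold expo
  have : (k : ℝ) ≤ m := by exact_mod_cast h
  exact one_div_le_one_div_of_le (by positivity) (by linarith)

open Filter Topology in
theorem expo_tendsto (R : ℝ) : Tendsto (expo R) atTop (𝓝 0) := by
  unfold expo
  refine Tendsto.div_atTop tendsto_const_nhds ?_
  simp only [add_assoc]
  exact tendsto_atTop_add_const_right _ _ tendsto_natCast_atTop_atTop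

open Filter Topology in
theorem karcher_unique (hw : w ∈ stdSimplex ℝ (Fin n)) (hB : ∀ i, IsStrictlyPositive (B i))
    {X Y : A} (hX : IsStrictlyPositive X) (hY : IsStrictlyPositive Y)
    (hXf : ∑ i, w i • CFC.log (rel X (B i)) = 0) (hYf : ∑ i, w i • CFC.log (rel Y (B i)) = 0) :
    X = Y := by
  obtain ⟨R, hR0, hRX, hRY⟩ : ∃ R : ℝ, 0 ≤ R ∧ (∀ i, TD R (B i) X) ∧ (∀ i, TD R (B i) Y) := by
    obtain ⟨s, hs0, hs⟩ := exists_TD_all hB hX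
    obtain ⟨t, ht0, ht⟩ := exists_TD_all hB hY
    exact ⟨max s t, le_max_of_le_left hs0,
      fun i => (hs i).mono (hB i).nonneg hX.nonneg (le_max_left _ _),
      fun i => (ht i).mono (hB i).nonneg hY.nonneg (le_max_right _ _)⟩
  have key : ∀ k, TD (expo R k * R ^ 2 + expo R k * R ^ 2) X Y := by
    intro k
    have hp0 := expo_pos hR0 k
    have hp1 := expo_le_one hR0 k
    have hε : 0 ≤ expo R k * R ^ 2 := by positivity
    obtain ⟨P, hP, hPf, hXP⟩ := pmap_exists hw hB hp0 hp1 hε hX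
      (pmap_near hw hB hp0 (expo_mul_le hR0 k) hX hRX hXf.le (one_le_sum_rpow' hw hB hX hXf))
    obtain ⟨Q, hQ, hQf, hYQ⟩ := pmap_exists hw hB hp0 hp1 hε hY
      (pmap_near hw hB hp0 (expo_mul_le hR0 k) hY hRY hYf.le (one_le_sum_rpow' hw hB hY hYf))
    rw [pmap_unique hw hB hp0 hp1 hQ hP hQf hPf] at hYQ
    exact hXP.trans hYQ.symm
  apply TD.eq_of_zero
  refine TD.tendsto tendsto_const_nhds tendsto_const_nhds ?_ (Eventually.of_forall key)
  have := ((expo_tendsto R).mul_const (R ^ 2)).add ((expo_tendsto R).mul_const (R ^ 2))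
  simpa using this

open Filter Topology in
theorem karcher_exists (hw : w ∈ stdSimplex ℝ (Fin n)) (hB : ∀ i, IsStrictlyPositive (B i)) :
    ∃ X : A, IsStrictlyPositive X ∧ ∑ i, w i • CFC.log (rel X (B i)) = 0 := by
  obtain ⟨M, hM0, hM⟩ := exists_TD_all hB (isStrictlyPositive_one (A := A))
  obtain ⟨R, hR⟩ : ∃ R : ℝ, R = M + M := ⟨_, rfl⟩
  have hR0 : 0 ≤ R := by linarith
  choose P hP hPf hP1 using fun k =>
    power_exists hw hB (expo_pos hR0 k) (expo_le_one hR0 k) hM0 hM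
  have hPR : ∀ k i, TD R (B i) (P k) := fun k i => by rw [hR]; exact (hM i).trans (hP1 k)
  have hnear : ∀ k m, k ≤ m →
      TD (expo R k * (expo R k * R ^ 2)) (P m) (pmap (expo R k) w B (P m)) := fun k m hkm =>
    pmap_near hw hB (expo_pos hR0 k) (expo_mul_le hR0 k) (hP m) (hPR m)
      (sum_log_le_zero hw hB (expo_pos hR0 m) (hP m) (hPf m))
      (one_le_sum_rpow hw hB (expo_pos hR0 m) (expo_anti hR0 hkm) (hP m) (hPf m))
  have hb0 : ∀ k, 0 ≤ expo R k * R ^ 2 := fun k => mul_nonneg (expo_pos hR0 k).le (sq_nonneg R)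
  have hb : Tendsto (fun k => expo R k * R ^ 2) atTop (𝓝 0) := by
    simpa using (expo_tendsto R).mul_const (R ^ 2)
  obtain ⟨X, hX, hlim, hTD⟩ := TD.exists_limit hP hb0 hb (by
    intro k m hkm
    obtain ⟨Q, hQ, hQf, hPQ⟩ := pmap_exists hw hB (expo_pos hR0 k) (expo_le_one hR0 k) (hb0 k)
      (hP m) (hnear k m hkm)
    rw [pmap_unique hw hB (expo_pos hR0 k) (expo_le_one hR0 k) hQ (hP k) hQf (hPf k)] at hPQ
    exact hPQ.symm)
  have hXR : ∀ i, TD R (B i) X := fun i =>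
    TD.tendsto tendsto_const_nhds hlim tendsto_const_nhds (Eventually.of_forall fun k => hPR k i)
  have hXnear : ∀ k, TD (expo R k * (expo R k * R ^ 2)) X (pmap (expo R k) w B X) := by
    intro k
    have h1 : ∀ᶠ m in atTop, TD (expo R m * R ^ 2 + expo R k * (expo R k * R ^ 2)
        + (1 - expo R k) * (expo R m * R ^ 2)) X (pmap (expo R k) w B X) :=
      (eventually_ge_atTop k).mono fun m hm => ((hTD m).symm.trans (hnear k m hm)).trans
        (pmap_TD hw hB (expo_pos hR0 k).le (expo_le_one hR0 k) (hP m) hX (hTD m))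
    refine TD.tendsto tendsto_const_nhds tendsto_const_nhds ?_ h1
    simpa using (hb.add_const (expo R k * (expo R k * R ^ 2))).add (hb.const_mul (1 - expo R k))
  have hT : ∀ i, IsStrictlyPositive (rel X (B i)) := fun i => rel_pos hX (hB i)
  refine ⟨X, hX, le_antisymm ?_ ?_⟩
  · have key : ∀ k, ∑ i, w i • CFC.log (rel X (B i)) ≤ (2 * (expo R k * R ^ 2)) • (1 : A) := by
      intro k
      have hp := expo_pos hR0 k
      have hpR := expo_mul_le hR0 k
      have hpR0 : 0 ≤ expo R k * R := mul_nonneg hp.le hR0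
      have hS := rel_le_of_le_smul hX (hXnear k).2
      rw [rel_pmap hX] at hS
      have h := sum_op_nonneg (a := 1) (p := expo R k) (d := 0) (q := 0) (b := -(expo R k))
        (c := -1) hw hT (by
        intro i x hx
        have := rpow_lower (p := expo R k) ((hT i).spectrum_pos hx)
        linarith)
      have he : Real.exp (expo R k * (expo R k * R ^ 2)) ≤ 1 + expo R k * (2 * (expo R k * R ^ 2)) := by
        have h0 : expo R k * (expo R k * R ^ 2) = (expo R k * R) ^ 2 := by ring
        have h1 : (expo R k * R) ^ 2 ≤ 1 := pow_le_one₀ hpR0 hpR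
        have h2 := Real.abs_exp_sub_one_sub_id_le (x := (expo R k * R) ^ 2)
          (by rw [abs_of_nonneg (sq_nonneg _)]; exact h1)
        have h3 := (abs_le.mp h2).2
        have h4 : ((expo R k * R) ^ 2) ^ 2 ≤ (expo R k * R) ^ 2 := by nlinarith [sq_nonneg (expo R k * R)]
        rw [h0]
        nlinarith
      have hS' := hS.trans (smul_le_smul_of_nonneg_right he zero_le_one)
      have h5 : expo R k • ∑ i, w i • CFC.log (rel X (B i))
          ≤ expo R k • ((2 * (expo R k * R ^ 2)) • (1 : A)) := by
        rw [add_smul, one_smul, mul_smul] at hS'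
        rw [← sub_nonneg] at hS' ⊢
        have := add_nonneg h hS'
        convert this using 1
        simp only [neg_smul, one_smul, zero_smul, add_zero]
        abel
      have h6 := smul_le_smul_of_nonneg_left h5 (inv_pos.mpr hp).le
      rwa [inv_smul_smul₀ hp.ne', inv_smul_smul₀ hp.ne'] at h6
    have hl : Tendsto (fun k => (2 * (expo R k * R ^ 2)) • (1 : A)) atTop (𝓝 0) := by
      simpa using (hb.const_mul 2).smul_const (1 : A)
    exact ge_of_tendsto' hl key
  · have key : ∀ k, (-(2 * (expo R k * R ^ 2))) • (1 : A) ≤ ∑ i, w i • CFC.log (rel X (B i)) := by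
      intro k
      have hp := expo_pos hR0 k
      have hpR := expo_mul_le hR0 k
      have hS : Real.exp (-(expo R k * (expo R k * R ^ 2))) • (1 : A) ≤
          ∑ i, w i • rel X (B i) ^ expo R k := by
        rw [← rel_pmap hX]
        refine smul_le_rel_of_smul_le hX ?_
        calc _ ≤ Real.exp (-(expo R k * (expo R k * R ^ 2))) •
              (Real.exp (expo R k * (expo R k * R ^ 2)) • pmap (expo R k) w B X) :=
              smul_le_smul_of_nonneg_left (hXnear k).1 (Real.exp_pos _).le
          _ = _ := by rw [smul_smul, ← Real.exp_add]; simp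
      have h := sum_op_nonneg (a := -1) (p := expo R k) (d := 0) (q := 0) (b := expo R k)
        (c := 1 + (expo R k * R) ^ 2) hw hT (by
        intro i x hx
        have := rpow_upper ((hT i).spectrum_pos hx) hp.le (log_abs_le hX (hB i) (hXR i) hx) hpR
        linarith)
      have he : 1 + expo R k * (-(expo R k * R ^ 2)) ≤
          Real.exp (-(expo R k * (expo R k * R ^ 2))) := by
        linarith [Real.add_one_le_exp (-(expo R k * (expo R k * R ^ 2)))]
      have hS' := (smul_le_smul_of_nonneg_right he (zero_le_one (α := A))).trans hS
      have h5 : expo R k • ((-(2 * (expo R k * R ^ 2))) • (1 : A)) ≤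
          expo R k • ∑ i, w i • CFC.log (rel X (B i)) := by
        rw [← sub_nonneg] at hS' ⊢
        have := add_nonneg h hS'
        convert this using 1
        rw [smul_smul]
        have e : expo R k * -(2 * (expo R k * R ^ 2)) =
          (1 + expo R k * -(expo R k * R ^ 2)) - (1 + (expo R k * R) ^ 2) := by ring
        rw [e, sub_smul]
        simp only [neg_smul, one_smul, zero_smul, add_zero]
        abel
      have h6 := smul_le_smul_of_nonneg_left h5 (inv_pos.mpr hp).le
      rwa [inv_smul_smul₀ hp.ne', inv_smul_smul₀ hp.ne'] at h6
    have hl : Tendsto (fun k => (-(2 * (expo R k * R ^ 2))) • (1 : A)) atTop (𝓝 0) := by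
      simpa using (hb.const_mul 2).neg.smul_const (1 : A)
    exact le_of_tendsto' hl key

theorem existsUnique_isPowerSolution (hw : w ∈ stdSimplex ℝ (Fin n))
    (hB : ∀ i, IsStrictlyPositive (B i)) {p : ℝ} (hp0 : 0 < p) (hp1 : p ≤ 1) :
    ∃! X : A, IsPowerSolution p w B X := by
  obtain ⟨M, hM0, hM⟩ := exists_TD_all hB (isStrictlyPositive_one (A := A))
  obtain ⟨X, hX, hXf, -⟩ := power_exists hw hB hp0 hp1 hM0 hM
  exact ⟨X, ⟨hX, hXf.symm⟩, fun Y hY => pmap_unique hw hB hp0 hp1 hY.1 hX hY.2.symm hXf⟩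

theorem log_ringInverse {T : A} (hT : IsStrictlyPositive T) :
    CFC.log T⁻¹ʳ = -CFC.log T := by
  have hr : ContinuousOn (fun x : ℝ => x ^ (-1 : ℝ)) (spectrum ℝ T) := fun x hx =>
    (Real.continuousAt_rpow_const _ _ (Or.inl (hT.spectrum_pos hx).ne')).continuousWithinAt
  have hl : ContinuousOn Real.log ((fun x : ℝ => x ^ (-1 : ℝ)) '' spectrum ℝ T) := by
    rintro _ ⟨x, hx, rfl⟩
    exact (Real.continuousAt_log
      (Real.rpow_pos_of_pos (hT.spectrum_pos hx) _).ne').continuousWithinAt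
  rw [CFC.inverse_eq_rpow_neg_one hT, CFC.rpow_eq_cfc_real hT.nonneg, CFC.log, CFC.log,
    ← cfc_comp' Real.log (fun x : ℝ => x ^ (-1 : ℝ)) T hl hr hT.isSelfAdjoint, ← cfc_neg]
  refine cfc_congr fun x hx => ?_
  simp [Real.log_rpow (hT.spectrum_pos hx)]

theorem ringInverse_rel {X Y : A} (hX : IsStrictlyPositive X) (hY : IsStrictlyPositive Y) :
    X ^ (1 / 2 : ℝ) * Y⁻¹ʳ * X ^ (1 / 2 : ℝ) = (rel X Y)⁻¹ʳ := by
  have h1 : rel X Y * (X ^ (1 / 2 : ℝ) * Y⁻¹ʳ * X ^ (1 / 2 : ℝ)) = 1 := by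
    unfold rel
    calc X ^ (-(1 / 2) : ℝ) * Y * X ^ (-(1 / 2) : ℝ) * (X ^ (1 / 2 : ℝ) * Y⁻¹ʳ * X ^ (1 / 2 : ℝ))
        = X ^ (-(1 / 2) : ℝ) * Y * (X ^ (-(1 / 2) : ℝ) * X ^ (1 / 2 : ℝ)) * Y⁻¹ʳ *
            X ^ (1 / 2 : ℝ) := by simp only [mul_assoc]
      _ = 1 := by
        rw [neg_half hX, mul_one, mul_assoc (X ^ (-(1 / 2) : ℝ)), Ring.mul_inverse_cancel _ hY.isUnit,
          mul_one, neg_half hX]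
  calc X ^ (1 / 2 : ℝ) * Y⁻¹ʳ * X ^ (1 / 2 : ℝ)
      = (rel X Y)⁻¹ʳ * (rel X Y * (X ^ (1 / 2 : ℝ) * Y⁻¹ʳ * X ^ (1 / 2 : ℝ))) := by
        rw [← mul_assoc, Ring.inverse_mul_cancel _ (rel_pos hX hY).isUnit, one_mul]
    _ = (rel X Y)⁻¹ʳ := by rw [h1, mul_one]

theorem isKarcherSolution_iff (hB : ∀ i, IsStrictlyPositive (B i)) {X : A} :
    IsKarcherSolution w B X ↔
      IsStrictlyPositive X ∧ ∑ i, w i • CFC.log (rel X (B i)) = 0 := by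
  refine and_congr_right fun hX => ?_
  have : ∑ i, w i • CFC.log (X ^ (1 / 2 : ℝ) * (B i)⁻¹ʳ * X ^ (1 / 2 : ℝ)) =
      -∑ i, w i • CFC.log (rel X (B i)) := by
    rw [← Finset.sum_neg_distrib]
    refine Finset.sum_congr rfl fun i _ => ?_
    rw [ringInverse_rel hX (hB i), log_ringInverse (rel_pos hX (hB i)), smul_neg]
  rw [this, neg_eq_zero]

theorem existsUnique_isKarcherSolution (hw : w ∈ stdSimplex ℝ (Fin n))
    (hB : ∀ i, IsStrictlyPositive (B i)) : ∃! X : A, IsKarcherSolution w B X := by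
  simp only [isKarcherSolution_iff hB]
  obtain ⟨X, hX, hXf⟩ := karcher_exists hw hB
  exact ⟨X, ⟨hX, hXf⟩, fun Y hY => karcher_unique hw hB hY.1 hX hY.2 hXf⟩

theorem powerMean_of_pos (hw : w ∈ stdSimplex ℝ (Fin n)) (hB : ∀ i, IsStrictlyPositive (B i))
    {p : ℝ} (hp0 : 0 < p) (hp1 : p ≤ 1) : IsPowerSolution p w B (powerMean p w B) := by
  rw [powerMean, if_pos hp0]
  exact Classical.epsilon_spec (existsUnique_isPowerSolution hw hB hp0 hp1).exists

theorem powerMean_zero (hw : w ∈ stdSimplex ℝ (Fin n)) (hB : ∀ i, IsStrictlyPositive (B i)) :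
    IsKarcherSolution w B (powerMean 0 w B) := by
  rw [powerMean, if_neg (lt_irrefl _), if_pos rfl]
  exact Classical.epsilon_spec (existsUnique_isKarcherSolution hw hB).exists

theorem powerMean_of_neg {p : ℝ} (hp : p < 0) :
    powerMean p w B = (powerMean (-p) w (fun i => (B i)⁻¹ʳ))⁻¹ʳ := by
  rw [powerMean, if_neg hp.le.not_gt, if_neg hp.ne, powerMean, if_pos (neg_pos.mpr hp)]

end OpMean

/-! The arithmetic mean mediates between the two sides. Write K for the Kantorovich constant of the
`mu j`. The proof is the chain P_p(λ; G^{μ_j/K}) ≤ ∑ λ_j G^{μ_j/K} ≤ G^{∑ λ_j μ_j/K} ≤ G^{P_p(λ;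
μ)}.

The first inequality, `powerMean_le_arithmetic`, is about power means alone. Each relative operator
T_i = X^{-1/2} B_i X^{-1/2} has its own functional calculus, so a scalar inequality between powers
and the logarithm holds for every T_i and survives averaging, although the T_i need not commute. The
defining equation of X evaluates one of the averaged terms, what remains is 1 ≤ ∑ w_i T_i, and
congruence by X^{1/2} gives the bound. For negative exponents the same argument is run on the
equation for the inverses.

The second inequality is Jensen's: r ↦ G^r is concave on [0, ∞) because G is jointly concave and the
shifts are affine in r (`OrderedMean.param_concaveOn`).

The third combines monotonicity of r ↦ G^r (`OrderedMean.param_mono`), a consequence of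
superadditivity of G, with the scalar bound ∑ λ_j μ_j/K ≤ P_p(λ; μ). This last bound is the only
place where the value of K matters: Kantorovich's inequality puts the arithmetic mean divided by K
below the harmonic mean, which is below every power mean with exponent at least -1. -/

namespace OpMean

open scoped Ring

/-! ### Operator power means against the arithmetic mean -/

section PowerMeanBounds

variable {A : Type*} [CStarAlgebra A] [PartialOrder A] [StarOrderedRing A]
variable {n : ℕ} {w : Fin n → ℝ} {B : Fin n → A}

/-- Both powers lie above their tangents in log x at x = 1, and the weight 1/q makes the two
logarithmic terms cancel. The effect is to turn a normalised average of q-th powers into a lower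
bound for the average of inverses, and conversely; both directions are used below. -/
theorem two_sided_rpow_bound {x q : ℝ} (hx : 0 < x) (hq : 0 < q) :
    1 + 1 / q ≤ x ^ (-1 : ℝ) + 1 / q * x ^ q := by
  have h1 := rpow_lower (p := -1) hx
  have h2 := mul_le_mul_of_nonneg_left (rpow_lower (p := q) hx) (one_div_pos.mpr hq).le
  have h3 : 1 / q * (1 + q * Real.log x) = 1 / q + Real.log x := by field_simp
  linarith

/-- Congruence by X^{1/2} preserves order, sends 1 to X and undoes each `rel X`. It reduces a
comparison with the arithmetic mean to a bound normalised at the identity. -/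
theorem le_sum_of_one_le_sum_rel {X : A} (hX : IsStrictlyPositive X)
    (h : 1 ≤ ∑ i, w i • rel X (B i)) : X ≤ ∑ i, w i • B i := by
  have h1 := IsSelfAdjoint.conjugate_le_conjugate h (rpow_isSelfAdjoint X (1 / 2))
  rw [mul_one, half_mul_half hX] at h1
  refine h1.trans_eq ?_
  simp only [Finset.mul_sum, Finset.sum_mul, mul_smul_comm, smul_mul_assoc, half_rel_half hX]

theorem rpow_one_of_pos {X : A} (hX : IsStrictlyPositive X) : X ^ (1 : ℝ) = X :=
  CFC.rpow_one X hX.nonneg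

/-- A solution of the power mean equation lies below the arithmetic mean. -/
theorem IsPowerSolution.le_arithmetic (hw : w ∈ stdSimplex ℝ (Fin n))
    (hB : ∀ i, IsStrictlyPositive (B i)) {p : ℝ} (hp0 : 0 < p) (hp1 : p ≤ 1) {X : A}
    (hX : IsPowerSolution p w B X) : X ≤ ∑ i, w i • B i := by
  refine le_sum_of_one_le_sum_rel hX.1 ?_
  -- Bernoulli's inequality compares the exponent p of the equation with the exponent 1.
  have h := one_le_sum_rpow hw hB hp0 hp1 hX.1 hX.2.symm
  simpa only [rpow_one_of_pos (rel_pos hX.1 (hB _))] using h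

/-- A solution of the Karcher equation lies below the arithmetic mean. -/
theorem IsKarcherSolution.le_arithmetic (hw : w ∈ stdSimplex ℝ (Fin n))
    (hB : ∀ i, IsStrictlyPositive (B i)) {X : A} (hX : IsKarcherSolution w B X) :
    X ≤ ∑ i, w i • B i := by
  refine le_sum_of_one_le_sum_rel hX.1 ?_
  -- The exponent 1 gives T ≥ 1 + log T for the relative operators T, and the averaged logarithm
  -- vanishes.
  have h := one_le_sum_rpow' (p := 1) hw hB hX.1 ((isKarcherSolution_iff hB).mp hX).2
  simpa only [rpow_one_of_pos (rel_pos hX.1 (hB _))] using h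

/-- The inverse of a solution of the power mean equation for the inverses lies below the
arithmetic mean. -/
theorem IsPowerSolution.ringInverse_le_arithmetic (hw : w ∈ stdSimplex ℝ (Fin n))
    (hB : ∀ i, IsStrictlyPositive (B i)) {q : ℝ} (hq0 : 0 < q) {Y : A}
    (hY : IsPowerSolution q w (fun i => (B i)⁻¹ʳ) Y) : Y⁻¹ʳ ≤ ∑ i, w i • B i := by
  have hB' : ∀ i, IsStrictlyPositive (B i)⁻¹ʳ := fun i => (hB i).ringInverse
  have hT : ∀ i, IsStrictlyPositive (rel Y (B i)⁻¹ʳ) := fun i => rel_pos hY.1 (hB' i)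
  have hS : ∑ i, w i • rel Y (B i)⁻¹ʳ ^ q = 1 := by
    rw [← rel_pmap hY.1, ← hY.2, rel_self hY.1]
  -- The coefficient of the logarithm is 0 because the scalar bound has already eliminated it.
  -- Inserting `hS` then leaves only the average of the inverses.
  have h := sum_op_nonneg (a := 1) (p := -1) (d := 1 / q) (q := q) (b := 0) (c := -(1 + 1 / q))
    hw hT (by
      intro i x hx
      have := two_sided_rpow_bound ((hT i).spectrum_pos hx) hq0
      linarith)
  have hinv : ∀ i, rel Y (B i)⁻¹ʳ ^ (-1 : ℝ) = Y ^ (1 / 2 : ℝ) * B i * Y ^ (1 / 2 : ℝ) := by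
    intro i
    rw [← CFC.inverse_eq_rpow_neg_one (hT i), ← ringInverse_rel hY.1 (hB' i),
      Ring.inverse_inverse (hB i).isUnit]
  have h1 : 1 ≤ ∑ i, w i • rel Y (B i)⁻¹ʳ ^ (-1 : ℝ) := by
    rw [hS] at h
    rw [← sub_nonneg]
    convert h using 1
    simp only [one_smul, zero_smul, add_zero, add_smul, neg_smul]
    abel
  simp only [hinv] at h1
  -- By `hinv` the inverses in `h1` are congruences of the `B i` by Y^{1/2}. Conjugating by Y^{-1/2}
  -- removes them and turns the identity on the left into Y⁻¹.
  have h2 := IsSelfAdjoint.conjugate_le_conjugate h1 (rpow_isSelfAdjoint Y (-(1 / 2)))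
  have h3 : Y ^ (-(1 / 2) : ℝ) * 1 * Y ^ (-(1 / 2) : ℝ) = Y⁻¹ʳ := by
    rw [mul_one, ← CFC.rpow_add hY.1.isUnit, CFC.inverse_eq_rpow_neg_one hY.1]
    norm_num
  rw [h3] at h2
  refine h2.trans_eq ?_
  simp only [Finset.mul_sum, Finset.sum_mul, mul_smul_comm, smul_mul_assoc]
  refine Finset.sum_congr rfl fun i _ => ?_
  congr 1
  exact rel_half hY.1

/-- The power means with exponent in `[-1, 1]` lie below the arithmetic mean. -/
theorem powerMean_le_arithmetic (hw : w ∈ stdSimplex ℝ (Fin n))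
    (hB : ∀ i, IsStrictlyPositive (B i)) {p : ℝ} (hp : p ∈ Set.Icc (-1 : ℝ) 1) :
    powerMean p w B ≤ ∑ i, w i • B i := by
  rcases lt_trichotomy p 0 with h | rfl | h
  · rw [powerMean_of_neg h]
    exact (powerMean_of_pos hw (fun i => (hB i).ringInverse) (neg_pos.mpr h)
      (by linarith [hp.1])).ringInverse_le_arithmetic hw hB (neg_pos.mpr h)
  · exact (powerMean_zero hw hB).le_arithmetic hw hB
  · exact (powerMean_of_pos hw hB h hp.2).le_arithmetic hw hB h hp.2

end PowerMeanBounds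

/-! ### Scalar power means and the Kantorovich inequality -/

section ScalarMeans

variable {n : ℕ} {w a : Fin n → ℝ}

theorem weighted_sum_pos (hw : w ∈ stdSimplex ℝ (Fin n)) (ha : ∀ i, 0 < a i) :
    0 < ∑ i, w i * a i := by
  obtain ⟨i, hi⟩ : ∃ i, 0 < w i := by
    by_contra! hcon
    have := Finset.sum_nonpos (s := Finset.univ) fun i _ => hcon i
    linarith [hw.2]
  exact Finset.sum_pos' (fun j _ => mul_nonneg (hw.1 j) (ha j).le)
    ⟨i, Finset.mem_univ i, mul_pos hi (ha i)⟩

/-- With t = x⁻¹ the left side is t^{-p}, concave in t since 0 < -p ≤ 1, and the right side is its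
tangent at t = 1. Bernoulli's inequality for the exponent 1/(-p) states this. -/
theorem rpow_le_of_neg_exponent {x p : ℝ} (hx : 0 < x) (hp : -1 ≤ p) (hp0 : p < 0) :
    x ^ p ≤ 1 + p + -p * x ^ (-1 : ℝ) := by
  have h1 := rpow_bern (p := 1) (q := -p) (Real.rpow_pos_of_pos hx (-1)) (neg_pos.mpr hp0)
    (by linarith)
  rw [← Real.rpow_mul hx.le, Real.rpow_one, neg_one_mul, neg_neg] at h1
  have h2 := mul_le_mul_of_nonneg_left h1 (neg_pos.mpr hp0).le
  rw [mul_add, ← mul_assoc, mul_one_div_cancel (neg_pos.mpr hp0).ne'] at h2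
  linarith

/-- The harmonic mean lies below the power means with exponent in `[-1, ∞)`. -/
theorem harmonic_le_scalarPowerMean (hw : w ∈ stdSimplex ℝ (Fin n)) (ha : ∀ i, 0 < a i)
    {p : ℝ} (hp : -1 ≤ p) : (∑ i, w i * (a i)⁻¹)⁻¹ ≤ scalarPowerMean p w a := by
  have hb := weighted_sum_pos hw fun i => inv_pos.mpr (ha i)
  obtain ⟨b, hbe⟩ : ∃ b, b = ∑ i, w i * (a i)⁻¹ := ⟨_, rfl⟩
  rw [← hbe] at hb ⊢
  -- Rescaling by b, the reciprocal of the harmonic mean, makes the harmonic mean of the numbers `a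
  -- i * b` equal to 1. It remains to compare their power mean with 1.
  have hab : ∀ i, 0 < a i * b := fun i => mul_pos (ha i) hb
  have hinv : ∑ i, w i * (a i * b) ^ (-1 : ℝ) = 1 := by
    simp only [Real.rpow_neg_one, mul_inv, ← mul_assoc, ← Finset.sum_mul]
    rw [← hbe, mul_inv_cancel₀ hb.ne']
  have hfac : ∑ i, w i * (a i * b) ^ p = (∑ i, w i * a i ^ p) * b ^ p := by
    rw [Finset.sum_mul]
    exact Finset.sum_congr rfl fun i _ => by rw [Real.mul_rpow (ha i).le hb.le, mul_assoc]
  have hS := weighted_sum_pos hw fun i => Real.rpow_pos_of_pos (ha i) p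
  unfold scalarPowerMean
  rcases lt_trichotomy p 0 with h | rfl | h
  · rw [if_neg h.ne]
    have h1 : ∑ i, w i * (a i * b) ^ p ≤ 1 := by
      calc ∑ i, w i * (a i * b) ^ p
          ≤ ∑ i, ((1 + p) * w i + -p * (w i * (a i * b) ^ (-1 : ℝ))) := by
            refine Finset.sum_le_sum fun i _ => ?_
            linarith [mul_le_mul_of_nonneg_left (rpow_le_of_neg_exponent (hab i) hp h) (hw.1 i)]
        _ = 1 := by
            rw [Finset.sum_add_distrib, ← Finset.mul_sum, ← Finset.mul_sum, hw.2, hinv]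
            ring
    rw [hfac] at h1
    have h2 : ∑ i, w i * a i ^ p ≤ b⁻¹ ^ p := by
      rw [Real.inv_rpow hb.le, ← one_div]
      exact (le_div_iff₀ (Real.rpow_pos_of_pos hb p)).mpr h1
    -- The outer exponent 1/p is negative, so the upper bound on the average of p-th powers becomes
    -- a lower bound on the mean.
    calc b⁻¹ = (b⁻¹ ^ p) ^ (1 / p) := by
          rw [one_div, Real.rpow_rpow_inv (inv_pos.mpr hb).le h.ne]
      _ ≤ _ := Real.rpow_le_rpow_of_nonpos hS h2 (one_div_neg.mpr h).le
  · rw [if_pos rfl]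
    -- For p = 0 this is the arithmetic-geometric mean inequality for the reciprocals.
    have h1 := Real.geom_mean_le_arith_mean_weighted Finset.univ w (fun i => (a i)⁻¹)
      (fun i _ => hw.1 i) hw.2 fun i _ => (inv_pos.mpr (ha i)).le
    simp only [Real.inv_rpow (ha _).le, Finset.prod_inv_distrib] at h1
    rw [← hbe] at h1
    exact inv_le_of_inv_le₀ (Finset.prod_pos fun i _ => Real.rpow_pos_of_pos (ha i) _) h1
  · rw [if_neg h.ne']
    have h1 : 1 ≤ ∑ i, w i * (a i * b) ^ p := by
      -- For p > 0 the average of inverses is normalised to 1, so the bound is now read in the other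
      -- direction: it controls the average of p-th powers from below.
      have h2 : ∑ i, w i * (1 + 1 / p) ≤
          ∑ i, (w i * (a i * b) ^ (-1 : ℝ) + 1 / p * (w i * (a i * b) ^ p)) := by
        refine Finset.sum_le_sum fun i _ => ?_
        have := mul_le_mul_of_nonneg_left (two_sided_rpow_bound (hab i) h) (hw.1 i)
        linarith
      rw [Finset.sum_add_distrib, ← Finset.sum_mul, ← Finset.mul_sum, hw.2, hinv, one_mul] at h2
      have h3 := mul_le_mul_of_nonneg_left (le_of_add_le_add_left h2) h.le
      rwa [← mul_assoc, mul_one_div_cancel h.ne', one_mul] at h3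
    rw [hfac] at h1
    have h2 : b⁻¹ ^ p ≤ ∑ i, w i * a i ^ p := by
      rw [Real.inv_rpow hb.le, ← one_div]
      exact (div_le_iff₀ (Real.rpow_pos_of_pos hb p)).mpr h1
    calc b⁻¹ = (b⁻¹ ^ p) ^ (1 / p) := by
          rw [one_div, Real.rpow_rpow_inv (inv_pos.mpr hb).le h.ne']
      _ ≤ _ := Real.rpow_le_rpow (Real.rpow_pos_of_pos (inv_pos.mpr hb) p).le h2
          (one_div_pos.mpr h).le

theorem iInf_pos_and_le (hw : w ∈ stdSimplex ℝ (Fin n)) (ha : ∀ i, 0 < a i) :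
    0 < (⨅ i, a i) ∧ 0 < (⨆ i, a i) ∧ ∀ i, (⨅ i, a i) ≤ a i ∧ a i ≤ ⨆ i, a i := by
  -- An empty family has total weight 0, not 1. Nonemptiness is what makes the infimum an attained,
  -- hence positive, value.
  have hne : Nonempty (Fin n) := by
    by_contra hcon
    rw [not_nonempty_iff] at hcon
    have := hw.2
    simp at this
  have hle : ∀ i, (⨅ i, a i) ≤ a i ∧ a i ≤ ⨆ i, a i := fun i =>
    ⟨ciInf_le (Set.finite_range a).bddBelow i, le_ciSup (Set.finite_range a).bddAbove i⟩
  obtain ⟨i, hi⟩ := exists_eq_ciInf_of_finite (f := a)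
  exact ⟨hi ▸ ha i, (ha i).trans_le (hle i).2, hle⟩

theorem kantorovich_pos (hw : w ∈ stdSimplex ℝ (Fin n)) (ha : ∀ i, 0 < a i) :
    0 < kantorovich a := by
  obtain ⟨hm, hM, -⟩ := iInf_pos_and_le hw ha
  unfold kantorovich
  positivity

/-- The Kantorovich inequality. -/
theorem arithmetic_mul_sum_inv_le_kantorovich (hw : w ∈ stdSimplex ℝ (Fin n))
    (ha : ∀ i, 0 < a i) : (∑ i, w i * a i) * (∑ i, w i * (a i)⁻¹) ≤ kantorovich a := by
  obtain ⟨hm, hM, hle⟩ := iInf_pos_and_le hw ha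
  unfold kantorovich
  generalize (⨅ i, a i) = m at *
  generalize (⨆ i, a i) = M at *
  have h1 := weighted_sum_pos hw ha
  have h2 := weighted_sum_pos hw fun i => inv_pos.mpr (ha i)
  -- Termwise this is (a - m)(M - a) ≥ 0 divided by a.
  have h3 : ∑ i, w i * a i + M * m * ∑ i, w i * (a i)⁻¹ ≤ M + m := by
    calc ∑ i, w i * a i + M * m * ∑ i, w i * (a i)⁻¹
        = ∑ i, w i * (a i + M * m * (a i)⁻¹) := by
          rw [Finset.mul_sum, ← Finset.sum_add_distrib]
          exact Finset.sum_congr rfl fun i _ => by ring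
      _ ≤ ∑ i, w i * (M + m) := by
          refine Finset.sum_le_sum fun i _ => mul_le_mul_of_nonneg_left ?_ (hw.1 i)
          have h4 : a i + M * m * (a i)⁻¹ = (a i * a i + M * m) / a i := by
            field_simp [(ha i).ne']
          rw [h4, div_le_iff₀ (ha i)]
          nlinarith [mul_nonneg (sub_nonneg.mpr (hle i).1) (sub_nonneg.mpr (hle i).2)]
      _ = M + m := by rw [← Finset.sum_mul, hw.2, one_mul]
  generalize ∑ i, w i * a i = s at *
  generalize ∑ i, w i * (a i)⁻¹ = t at *
  rw [le_div_iff₀ (by positivity)]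
  -- Since 4(Mm)st ≤ (s + Mmt)², squaring the linear bound yields a bound on the product st.
  have h5 : (s + M * m * t) ^ 2 ≤ (M + m) ^ 2 := pow_le_pow_left₀ (by positivity) h3 2
  nlinarith [sq_nonneg (s - M * m * t)]

theorem sum_div_kantorovich_le_scalarPowerMean (hw : w ∈ stdSimplex ℝ (Fin n))
    (ha : ∀ i, 0 < a i) {p : ℝ} (hp : -1 ≤ p) :
    ∑ i, w i * (a i / kantorovich a) ≤ scalarPowerMean p w a := by
  refine le_trans ?_ (harmonic_le_scalarPowerMean hw ha hp)
  have hb := weighted_sum_pos hw fun i => inv_pos.mpr (ha i)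
  simp only [← mul_div_assoc, ← Finset.sum_div]
  rw [← one_div, div_le_div_iff₀ (kantorovich_pos hw ha) hb, one_mul]
  exact arithmetic_mul_sum_inv_le_kantorovich hw ha

end ScalarMeans

/-! ### The function r ↦ G^r is increasing and concave -/

namespace OrderedMean

variable {A : Type*} [CStarAlgebra A] [PartialOrder A] [StarOrderedRing A]
variable {n : ℕ} {w : Fin n → ℝ} {X Y : Fin n → A}

/-- A concave, positively homogeneous map is superadditive: apply concavity at the midpoint of 2X
and 2Y, and let homogeneity cancel the factors. -/
theorem toFun_add_le (G : OrderedMean A) (hw : w ∈ stdSimplex ℝ (Fin n))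
    (hX : ∀ i, IsStrictlyPositive (X i)) (hY : ∀ i, IsStrictlyPositive (Y i)) :
    G.toFun n w X + G.toFun n w Y ≤ G.toFun n w (fun i => X i + Y i) := by
  have h := G.jointlyConcave (s := 1 / 2) hw (fun i => (hX i).smul (two_pos : (0 : ℝ) < 2))
    (fun i => (hY i).smul (two_pos : (0 : ℝ) < 2)) (by norm_num) (by norm_num)
  rw [G.homogeneous hw hX two_pos, G.homogeneous hw hY two_pos] at h
  simp only [smul_smul] at h
  norm_num at h
  exact h

/-- The harmonic and arithmetic bounds coincide on this tuple. -/
theorem toFun_const_one (G : OrderedMean A) (hw : w ∈ stdSimplex ℝ (Fin n)) :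
    G.toFun n w (fun _ => (1 : A)) = 1 := by
  have h1 := G.harmonic_le hw fun _ : Fin n => isStrictlyPositive_one (A := A)
  have h2 := G.le_arithmetic hw fun _ : Fin n => isStrictlyPositive_one (A := A)
  simp only [Ring.inverse_one, ← Finset.sum_smul, hw.2, one_smul] at h1 h2
  exact le_antisymm h2 h1

theorem add_smul_one_pos {X : A} (hX : IsStrictlyPositive X) {m : ℝ} (hm : 0 ≤ m) :
    IsStrictlyPositive (X + m • (1 : A)) :=
  hX.of_le (le_add_of_nonneg_right (smul_nonneg hm zero_le_one))

/-- By superadditivity, shifting every entry by a further (s - r)I raises G by at least its value on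
that constant tuple, which is (s - r)I. This pays exactly for the larger multiple of I subtracted in
G^s. -/
theorem param_mono (G : OrderedMean A) (hw : w ∈ stdSimplex ℝ (Fin n))
    (hX : ∀ i, IsStrictlyPositive (X i)) {r s : ℝ} (hr : 0 ≤ r) (hrs : r ≤ s) :
    G.param r w X ≤ G.param s w X := by
  rcases hrs.eq_or_lt with rfl | hlt
  · exact le_rfl
  have h := G.toFun_add_le hw (fun i => add_smul_one_pos (hX i) hr)
    (fun _ : Fin n => isStrictlyPositive_one.smul (sub_pos.mpr hlt))
  rw [G.homogeneous hw (fun _ => isStrictlyPositive_one) (sub_pos.mpr hlt),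
    G.toFun_const_one hw] at h
  simp only [add_assoc, ← add_smul, add_sub_cancel] at h
  rw [param, param, if_pos hr, if_pos (hr.trans hrs), le_sub_iff_add_le]
  refine le_trans (le_of_eq ?_) h
  rw [sub_smul]
  abel

theorem param_isStrictlyPositive (G : OrderedMean A) (hw : w ∈ stdSimplex ℝ (Fin n))
    (hX : ∀ i, IsStrictlyPositive (X i)) {r : ℝ} (hr : 0 ≤ r) :
    IsStrictlyPositive (G.param r w X) := by
  have h := G.param_mono hw hX le_rfl hr
  refine IsStrictlyPositive.of_le ?_ h
  -- At parameter 0 the shifts vanish, so G^0 is G itself, a positive definite lower bound for G^r.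
  simpa [param] using G.isStrictlyPositive hw hX

/-- The shifted tuple is affine in r, so joint concavity of G restricts to concavity along this
line; subtracting the linear term rI does not affect it. -/
theorem param_concaveOn (G : OrderedMean A) (hw : w ∈ stdSimplex ℝ (Fin n))
    (hX : ∀ i, IsStrictlyPositive (X i)) :
    ConcaveOn ℝ (Set.Ici 0) (fun r => G.param r w X) := by
  refine ⟨convex_Ici 0, fun r hr s hs a b ha hb hab => ?_⟩
  obtain rfl : a = 1 - b := by linarith
  simp only [Set.mem_Ici] at hr hs
  have h := G.jointlyConcave hw (fun i => add_smul_one_pos (hX i) hr)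
    (fun i => add_smul_one_pos (hX i) hs) hb (by linarith)
  have hrs : 0 ≤ (1 - b) • r + b • s := by simp only [smul_eq_mul]; positivity
  have e : ∀ i, (1 - b) • (X i + r • (1 : A)) + b • (X i + s • (1 : A)) =
      X i + ((1 - b) • r + b • s) • (1 : A) := fun i => by
    simp only [smul_eq_mul]
    module
  simp only [e] at h
  simp only [param, if_pos hr, if_pos hs, if_pos hrs]
  rw [le_sub_iff_add_le]
  refine le_trans (le_of_eq ?_) h
  simp only [smul_eq_mul]
  module

end OrderedMean

end OpMean

theorem mainTheorem8 {H : Type*} [NormedAddCommGroup H] [InnerProductSpace ℂ H] [CompleteSpace H]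
    (G : OpMean.OrderedMean (H →L[ℂ] H)) {n k : ℕ}
    (A : Fin n → (H →L[ℂ] H)) (hA : ∀ i, IsStrictlyPositive (A i))
    (omega : Fin n → ℝ) (homega : omega ∈ stdSimplex ℝ (Fin n))
    (lam : Fin k → ℝ) (hlam : lam ∈ stdSimplex ℝ (Fin k))
    (mu : Fin k → ℝ) (hmu : ∀ j, 0 < mu j) (p : ℝ) (hp : p ∈ Set.Ico (-1 : ℝ) 1) :
    OpMean.powerMean p lam (fun j => G.param (mu j / OpMean.kantorovich mu) omega A) ≤
      G.param (OpMean.scalarPowerMean p lam mu) omega A := by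
  have hd : ∀ j, 0 < mu j / OpMean.kantorovich mu := fun j =>
    div_pos (hmu j) (OpMean.kantorovich_pos hlam hmu)
  calc OpMean.powerMean p lam (fun j => G.param (mu j / OpMean.kantorovich mu) omega A)
      ≤ ∑ j, lam j • G.param (mu j / OpMean.kantorovich mu) omega A :=
        OpMean.powerMean_le_arithmetic hlam
          (fun j => G.param_isStrictlyPositive homega hA (hd j).le) ⟨hp.1, hp.2.le⟩
    _ ≤ G.param (∑ j, lam j • (mu j / OpMean.kantorovich mu)) omega A :=
        -- Jensen's inequality in the parameter, with weights `lam`.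
        (G.param_concaveOn homega hA).le_map_sum (fun j _ => hlam.1 j) hlam.2
          fun j _ => (hd j).le
    _ ≤ G.param (OpMean.scalarPowerMean p lam mu) omega A :=
        -- Division by K has brought the averaged parameter below the scalar power mean.
        G.param_mono homega hA (OpMean.weighted_sum_pos hlam hd).le
          (OpMean.sum_div_kantorovich_le_scalarPowerMean hlam hmu hp.1)
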